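/- **Conventions.** For a discrete group $G$, a subset $S\subseteq G$ and a unitary representation $V$ of $G$ (on a complex Hilbert space), let $\kappa(G,S,V)$ be the infimum of all $\varepsilon>0$ for which there is $0\neq v\in V$ with $\|sv-v\|\le\varepsilon\|v\|$ for all $s\in S$ (with $\inf\emptyset=\infty$), and let $\kappa(G,S)$ be the infimum of $\kappa(G,S,V)$ over all unitary representations $V$ of $G$ without nonzero invariant vectors. $G$ has property $(T)$ if $\kappa(G,S)>0$ for some finite $S\subseteq G$. Rings are associative with $1$, modules are unital. **Part 1.** Let $d\ge 1$, let $X$ be a finite graph without loops or multiple edges, with vertex set $\{1,\dots,d\}$ and edge set $E(X)$. Let $M_1,\dots,M_d$ be abelian groups, each finitely generated as a group, and for every edge $(i,j)\in E(X)$ with $i<j$ let $R_{ij}$ be a ring such that $M_i$ is a right $R_{ij}$-module and $M_j$ is a left $R_{ij}$-module. Let $G=G(X,\{M_i\},\{R_{ij}\})$ be the mixed Kac–Moody–Steinberg group, i.e. the group generated by the symbols $x_i(a)$ ($1\le i\le d$, $a\in M_i$) subject to the relations * $x_i(a)x_i(a')=x_i(a+a')$; * $[x_i(a),x_j(b)]=1$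 if $(i,j)\notin E(X)$; * $[x_i(ar),x_j(b)]=[x_i(a),x_j(rb)]$ for $r\in R_{ij}$, and $[x_i(a),x_j(b)]$ commutes with all $x_i(c)$ and all $x_j(c')$, if $i<j$ and $(i,j)\in E(X)$. Put $G_i=\{x_i(a):a\in M_i\}$. Let $m_{ij}$ be the minimal index of a proper right ideal of $R_{ij}$ ($\infty$ if there is none of finite index) and $m=\min m_{ij}$ over all edges ($m=\infty$ if there are no edges). If $m>(d-1)^2$, then $$\kappa\Big(G,\bigcup_i G_i\Big)\ \ge\ \sqrt{\frac2d\Big(1-\frac{d-1}{\sqrt m}\Big)}$$ (where $1/\sqrt\infty=0$). In particular, if all $M_i$ are finite, then $G$ has property $(T)$. **Part 2.** Let $d\geq 1$, let $A$ be a $d\times d$ generalized Cartan matrix all of whose off-diagonal entries are $0$ or $-1$, let $F$ be a finite field, and let $G_{KM}(A,F)$ be the corresponding simply-connected Kac–Moody group (in the sense of Tits). Let $U=U(A,F)$ be its positive unipotent subgroup, that is, the subgroup generated by the positive real root subgroups, and let $S\subseteq U$ be the union of the $d$ simple root subgroups. If $|F|>(d-1)^2$, then $U$ has property $(T)$ and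 $$\kappa(U,S)\ \ge\ \sqrt{\frac2d\Big(1-\frac{d-1}{\sqrt{|F|}}\Big)}.$$ -/

import Mathlib

open scoped ENNReal commutatorElement

/-! ### Kazhdan constants and property (T) of discrete groups -/

/-- A unitary representation of the discrete group `G` on the complex Hilbert space `V`. -/
abbrev UnitaryRep (G : Type*) [Group G] (V : Type*) [NormedAddCommGroup V]
    [InnerProductSpace ℂ V] : Type _ :=
  G →* (V ≃ₗᵢ[ℂ] V)

/-- The representation has no nonzero invariant vectors. -/
def UnitaryRep.NoInvariants {G : Type*} [Group G] {V : Type*} [NormedAddCommGroup V]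
    [InnerProductSpace ℂ V] (π : UnitaryRep G V) : Prop :=
  ∀ v : V, (∀ g : G, π g v = v) → v = 0

/-- The nonzero vector `v` is `(S, ε)`-invariant. -/
def UnitaryRep.IsAlmostInvariant {G : Type*} [Group G] {V : Type*} [NormedAddCommGroup V]
    [InnerProductSpace ℂ V] (π : UnitaryRep G V) (S : Set G) (ε : ℝ) (v : V) : Prop :=
  v ≠ 0 ∧ ∀ s ∈ S, ‖π s v - v‖ ≤ ε * ‖v‖

/-- The Kazhdan constant `κ(G, S, V)`; the infimum of the empty set is `∞`. -/
noncomputable def UnitaryRep.kazhdanConst {G : Type*} [Group G] {V : Type*}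
    [NormedAddCommGroup V] [InnerProductSpace ℂ V] (π : UnitaryRep G V) (S : Set G) : ℝ≥0∞ :=
  ⨅ (ε : ℝ) (_ : 0 < ε ∧ ∃ v : V, π.IsAlmostInvariant S ε v), ENNReal.ofReal ε

/-- The Kazhdan constant `κ(G, S)`: the infimum of `κ(G, S, V)` over all unitary representations
of `G` without nonzero invariant vectors, on Hilbert spaces `V` in an arbitrary universe `v`. -/
noncomputable def kazhdanConst.{v, u} (G : Type u) [Group G] (S : Set G) : ℝ≥0∞ :=
  ⨅ (V : Type v) (_ : NormedAddCommGroup V) (_ : InnerProductSpace ℂ V) (_ : CompleteSpace V)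
    (π : UnitaryRep G V) (_ : π.NoInvariants), π.kazhdanConst S

/-- Kazhdan's property (T) for a discrete group. -/
def HasPropertyT.{v, u} (G : Type u) [Group G] : Prop :=
  ∃ S : Set G, S.Finite ∧ 0 < kazhdanConst.{v} G S

/-! ### Mixed Kac-Moody-Steinberg groups -/

/-- The edges `(i, j)`, `i < j`, of a graph with vertices `0, …, d - 1`. -/
abbrev KMSEdge {d : ℕ} (X : SimpleGraph (Fin d)) : Type :=
  {e : Fin d × Fin d // e.1 < e.2 ∧ X.Adj e.1 e.2}

section KMS

variable {d : ℕ} (X : SimpleGraph (Fin d)) (M : Fin d → Type*) [∀ i, AddCommGroup (M i)]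
  (R : KMSEdge X → Type*) [∀ e, Ring (R e)]
  [∀ e : KMSEdge X, Module (R e)ᵐᵒᵖ (M e.1.1)] [∀ e : KMSEdge X, Module (R e) (M e.1.2)]

/-- The free generator `x_i(a)`. -/
abbrev KMSGen (i : Fin d) (a : M i) : FreeGroup (Σ i, M i) :=
  FreeGroup.of ⟨i, a⟩

/-- The defining relators of the mixed Kac-Moody-Steinberg group. The right action of `r` on
`a : M i` is written `MulOpposite.op r • a`. -/
inductive KMSRelator : FreeGroup (Σ i, M i) → Prop
  | add (i : Fin d) (a a' : M i) :
      KMSRelator (KMSGen M i a * KMSGen M i a' * (KMSGen M i (a + a'))⁻¹)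
  | comm (i j : Fin d) (h : ¬ X.Adj i j) (a : M i) (b : M j) :
      KMSRelator ⁅KMSGen M i a, KMSGen M j b⁆
  | balanced (e : KMSEdge X) (a : M e.1.1) (b : M e.1.2) (r : R e) :
      KMSRelator (⁅KMSGen M e.1.1 (MulOpposite.op r • a), KMSGen M e.1.2 b⁆ *
        ⁅KMSGen M e.1.1 a, KMSGen M e.1.2 (r • b)⁆⁻¹)
  | central_left (e : KMSEdge X) (a : M e.1.1) (b : M e.1.2) (c : M e.1.1) :
      KMSRelator ⁅⁅KMSGen M e.1.1 a, KMSGen M e.1.2 b⁆, KMSGen M e.1.1 c⁆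
  | central_right (e : KMSEdge X) (a : M e.1.1) (b : M e.1.2) (c : M e.1.2) :
      KMSRelator ⁅⁅KMSGen M e.1.1 a, KMSGen M e.1.2 b⁆, KMSGen M e.1.2 c⁆

/-- The mixed Kac-Moody-Steinberg group `G(X, {M_i}, {R_ij})`. -/
abbrev KMSGroup : Type _ :=
  PresentedGroup {w | KMSRelator X M R w}

/-- The union of the subgroups `G_i = {x_i(a) : a ∈ M_i}` of the mixed KMS group. -/
def KMSGroup.vertexUnion : Set (KMSGroup X M R) :=
  {g | ∃ (i : Fin d) (a : M i), g = PresentedGroup.of ⟨i, a⟩}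

end KMS

/-- The minimal index of a proper right ideal of `A`
(`⊤` if there is no proper right ideal of finite index). -/
noncomputable def minRightIdealIndex (A : Type*) [Ring A] : ℕ∞ :=
  ⨅ (I : Submodule Aᵐᵒᵖ A) (_ : I ≠ ⊤), ENat.card (A ⧸ I)

/-- `1 / √m`, with the convention `1 / √∞ = 0`. -/
noncomputable def ENat.invSqrt (m : ℕ∞) : ℝ :=
  Real.sqrt ((m : ℝ≥0∞)⁻¹).toReal

/-! ### Simply-laced Kac-Moody groups -/

/-- Generalized Cartan matrices. -/
structure IsGeneralizedCartan {d : ℕ} (A : Matrix (Fin d) (Fin d) ℤ) : Prop where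
  diag : ∀ i, A i i = 2
  off_diag : ∀ i j, i ≠ j → A i j ≤ 0
  zero_iff : ∀ i j, A i j = 0 ↔ A j i = 0

namespace KacMoody

variable {d : ℕ} (A : Matrix (Fin d) (Fin d) ℤ)

/-- The simple root `α_i` in the free root lattice. -/
abbrev simpleRoot (i : Fin d) : Fin d → ℤ := Pi.single i 1

/-- The simple reflection `γ ↦ γ - ⟨γ, h_i⟩ α_i`, where `⟨α_j, h_i⟩ = A i j`. -/
def reflection (i : Fin d) : Module.End ℤ (Fin d → ℤ) :=
  LinearMap.id - ((LinearMap.proj i).comp (Matrix.mulVecLin A)).smulRight (simpleRoot i)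

/-- The Weyl group (the simple reflections of a generalized Cartan matrix are involutions, so the
monoid that they generate is a group). -/
def weyl : Submonoid (Module.End ℤ (Fin d → ℤ)) :=
  Submonoid.closure (Set.range (reflection A))

/-- Real roots. -/
def IsRealRoot (γ : Fin d → ℤ) : Prop :=
  ∃ w ∈ weyl A, ∃ i, γ = w (simpleRoot i)

/-- The pair `{α, β}` is prenilpotent: some Weyl group element makes both roots positive and
some Weyl group element makes both negative. -/
def IsPrenilpotent (α β : Fin d → ℤ) : Prop :=
  (∃ w ∈ weyl A, 0 ≤ w α ∧ 0 ≤ w β) ∧ (∃ w ∈ weyl A, w α ≤ 0 ∧ w β ≤ 0)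

/-- The Kac-Moody algebra of `A` (generators `E_i, F_i, H_i`, Serre relations). -/
abbrev Alg : Type := Matrix.ToLieAlgebra ℂ A

/-- The Chevalley generator `E_i`. -/
noncomputable def E (i : Fin d) : Alg A :=
  LieSubmodule.Quotient.mk (FreeLieAlgebra.of ℂ (CartanMatrix.Generators.E i))

/-- The Chevalley generator `F_i`. -/
noncomputable def F (i : Fin d) : Alg A :=
  LieSubmodule.Quotient.mk (FreeLieAlgebra.of ℂ (CartanMatrix.Generators.F i))

/-- `exp(ad x) y`, for locally nilpotent `ad x` (a finite sum). -/
noncomputable def expAd (x y : Alg A) : Alg A :=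
  ∑ᶠ n : ℕ, ((n.factorial : ℂ)⁻¹) • ((LieAlgebra.ad ℂ (Alg A) x) ^ n) y

/-- The automorphism `s_i^* = exp(ad E_i) exp(-ad F_i) exp(ad E_i)` lifting the `i`-th simple
reflection. -/
noncomputable def reflAut (i : Fin d) (y : Alg A) : Alg A :=
  expAd A (E A i) (expAd A (-F A i) (expAd A (E A i) y))

/-- `IsRealRootVector A γ e`: the vector `e` is one of the two opposite generators of the
integral root space of the real root `γ`. These are the images of `±E_i, ±F_i` under the `s_j^*`. -/
inductive IsRealRootVector : (Fin d → ℤ) → Alg A → Prop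
  | pos (i : Fin d) : IsRealRootVector (simpleRoot i) (E A i)
  | neg (i : Fin d) : IsRealRootVector (-simpleRoot i) (F A i)
  | opp {γ : Fin d → ℤ} {e : Alg A} (h : IsRealRootVector γ e) : IsRealRootVector γ (-e)
  | refl (i : Fin d) {γ : Fin d → ℤ} {e : Alg A} (h : IsRealRootVector γ e) :
      IsRealRootVector (reflection A i γ) (reflAut A i e)

/-- A real root together with a generator of its integral root space. -/
structure RootVector where
  root : Fin d → ℤ
  vec : Alg A
  isReal : IsRealRootVector A root vec

namespace RootVector

variable {A}

/-- `-e` as a root vector for the same root. -/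
noncomputable def opp (e : RootVector A) : RootVector A := ⟨e.root, -e.vec, e.isReal.opp⟩

/-- `s_i^* e`. -/
noncomputable def refl (i : Fin d) (e : RootVector A) : RootVector A :=
  ⟨reflection A i e.root, reflAut A i e.vec, e.isReal.refl i⟩

variable (A)

/-- `E_i` as a root vector. -/
noncomputable def simple (i : Fin d) : RootVector A := ⟨simpleRoot i, E A i, .pos i⟩

/-- `F_i` as a root vector. -/
noncomputable def negSimple (i : Fin d) : RootVector A := ⟨-simpleRoot i, F A i, .neg i⟩

end RootVector

section Presentation

variable (K : Type*) [Field K]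

/-- Generators of the Kac-Moody group over the field `K`: the elements `x_e(a) = "exp(a e)"` of
the real root groups and the elements `h_i(t)` of the torus. -/
inductive Gen
  | x (e : RootVector A) (a : K)
  | h (i : Fin d) (t : Kˣ)

/-- The root group element `x_e(a)` in the free group. -/
abbrev x {A : Matrix (Fin d) (Fin d) ℤ} {K : Type*} (e : RootVector A) (a : K) [Field K] :
    FreeGroup (Gen A K) :=
  FreeGroup.of (Gen.x e a)

/-- The torus element `h_i(t)` in the free group. -/
abbrev h {K : Type*} [Field K] (i : Fin d) (t : Kˣ) : FreeGroup (Gen A K) :=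
  FreeGroup.of (Gen.h i t)

/-- The element `n_i(t) = x_i(t) x_{-i}(-t⁻¹) x_i(t)` in the free group. -/
noncomputable def n {K : Type*} [Field K] (i : Fin d) (t : Kˣ) : FreeGroup (Gen A K) :=
  x (RootVector.simple A i) (t : K) * x (RootVector.negSimple A i) (-((t⁻¹ : Kˣ) : K)) *
    x (RootVector.simple A i) (t : K)

/-- Tits' defining relations for the simply-connected Kac-Moody group of a simply-laced
generalized Cartan matrix. For such a matrix the only real root of the form `pα + qβ`, with
`p, q ≥ 1` and `{α, β}` a prenilpotent pair of real roots, is `α + β`, if that is a real root at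
all; in that case the bracket of generators of the integral root spaces of `α` and `β` generates
the integral root space of `α + β`. So these are all the commutation relations. -/
inductive Relator : FreeGroup (Gen A K) → Prop
  | add (e : RootVector A) (a b : K) : Relator (x e a * x e b * (x e (a + b))⁻¹)
  | opp (e : RootVector A) (a : K) : Relator (x e.opp a * (x e (-a))⁻¹)
  | bracket (e f : RootVector A) (a b : K) (hp : IsPrenilpotent A e.root f.root)
      (hs : IsRealRootVector A (e.root + f.root) ⁅e.vec, f.vec⁆) :
      Relator (⁅x e a, x f b⁆ * (x ⟨e.root + f.root, ⁅e.vec, f.vec⁆, hs⟩ (a * b))⁻¹)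
  | comm (e f : RootVector A) (a b : K) (hp : IsPrenilpotent A e.root f.root)
      (hs : ¬ IsRealRoot A (e.root + f.root)) :
      Relator ⁅x e a, x f b⁆
  | torus_mul (i : Fin d) (s t : Kˣ) : Relator (h A i s * h A i t * (h A i (s * t))⁻¹)
  | torus_comm (i j : Fin d) (s t : Kˣ) : Relator ⁅h A i s, h A j t⁆
  | torus_root (i j : Fin d) (t : Kˣ) (a : K) :
      Relator (h A i t * x (RootVector.simple A j) a * (h A i t)⁻¹ *
        (x (RootVector.simple A j) (((t ^ (A i j) : Kˣ) : K) * a))⁻¹)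
  | weyl_torus (i j : Fin d) (t : Kˣ) :
      Relator (n A i (1 : Kˣ) * h A j t * (n A i (1 : Kˣ))⁻¹ *
        (h A j t * h A i (t ^ (-(A j i))))⁻¹)
  | torus_eq (i : Fin d) (t : Kˣ) :
      Relator (n A i t⁻¹ * (n A i (1 : Kˣ) * h A i t)⁻¹)
  | weyl_root (i : Fin d) (e : RootVector A) (a : K) :
      Relator (n A i (1 : Kˣ) * x e a * (n A i (1 : Kˣ))⁻¹ * (x (e.refl i) a)⁻¹)

/-- The simply-connected Kac-Moody group `G_KM(A, K)` of a simply-laced generalized Cartan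
matrix `A` over the field `K`. -/
abbrev KMGroup : Type _ :=
  PresentedGroup {w | Relator A K w}

/-- The root group element `x_e(a)` of the Kac-Moody group. -/
def rootElt {A : Matrix (Fin d) (Fin d) ℤ} {K : Type*} [Field K] (e : RootVector A) (a : K) :
    KMGroup A K :=
  PresentedGroup.of (Gen.x e a)

/-- The positive unipotent subgroup: the subgroup generated by the positive (real) root
subgroups. -/
def positiveUnipotent : Subgroup (KMGroup A K) :=
  Subgroup.closure {g | ∃ (e : RootVector A) (a : K), 0 ≤ e.root ∧ g = rootElt e a}

/-- The union of the simple root subgroups, as a subset of the positive unipotent subgroup. -/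
def simpleRootUnion : Set (positiveUnipotent A K) :=
  {g | ∃ (i : Fin d) (a : K), (g : KMGroup A K) = rootElt (RootVector.simple A i) a}

end Presentation

end KacMoody

universe u w v

/-! Both groups are generated by abelian subgroups $G_1,\dots,G_d$ such that, for any two of them,
the commutators of their elements are central in the subgroup that the two generate. Let $V_i$ be
the space of $G_i$-fixed vectors; absence of invariant vectors means $\bigcap V_i=0$. Three
estimates give the bound.

(a) If the cosine of the angle between any two $V_i$ is at most $\varepsilon=1/\sqrt m$, then
$\sum_i\mathrm{dist}(v,V_i)^2\ge(1-(d-1)\varepsilon)\|v\|^2$. Indeed $T=\sum_i P_{V_i^\perp}$ is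
positive and injective, and the angles give $T^2\ge(1-(d-1)\varepsilon)T$
(`sum_norm_sub_starProjection_sq_ge`).

(b) If $G_i$ moves $v$ by at most $\delta\|v\|$, then $\mathrm{dist}(v,V_i)^2\le\delta^2\|v\|^2/2$,
by the shortest vector in the closed convex hull of an orbit
(`UnitaryRep.two_mul_norm_sub_proj_sq_le`). With (a) this yields
$d\,\delta^2/2\ge1-(d-1)\varepsilon$, in `ofReal_sqrt_le_kazhdanConst`.

(c) The angle of a pair $a:A\to G$, $b:B\to G$ with central commutators
(`CentralPair.mul_norm_proj_sq_le`). Where the commutators act trivially the two families commute,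
so only vectors $v$ without commutator-fixed component matter. For $b$-fixed $v$, the coefficient
$\langle a(x)v,v\rangle$ sees only the part of $v$ fixed by all $[a(x),b(y)]$. Average $a$ over a
large box in the finitely generated group $A$ and decompose $v$ into joint eigenvectors $w$ of the
projections onto these parts. For each $w\neq0$, the $x$ whose commutators fix $w$ form a proper
subgroup of $A$ compatible with the commutator pairing. If such subgroups have index at least $N$,
they meet translates of the box in proportion about $1/N$, whence $\|P_av\|^2\le\|v\|^2/N$.

In the Steinberg setting the compatible subgroups are $R_{ij}$-submodules, and a proper one has
index at least that of a proper right ideal. In the Kac–Moody setting they are subspaces of the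
field $F$, so the index is $|F|$. There it remains to show that the simple root subgroups generate
$U$ (`positiveUnipotent_eq_simpleSubgroup`), by induction on length in the Weyl group using lifts of
Weyl group elements to the normalizer of the torus. -/

section Subspaces

/-! ### Angles between subspaces of a Hilbert space. -/

variable {V : Type*} [NormedAddCommGroup V] [InnerProductSpace ℂ V]

/-- If the cosine of the angle between `K` and `L` is at most `ε`, then so is, in a quadratic form
sense, that between their orthogonal complements. -/
theorem re_inner_sub_starProjection_ge (K L : Submodule ℂ V) [K.HasOrthogonalProjection]
    [L.HasOrthogonalProjection] [(K ⊓ L).HasOrthogonalProjection] {ε : ℝ} (hε : 0 ≤ ε)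
    (hε1 : ε ≤ 1)
    (h : ∀ y ∈ L, y ∈ (K ⊓ L)ᗮ → ‖K.starProjection y‖ ≤ ε * ‖y‖) (v : V) :
    -(ε * (‖v - K.starProjection v‖ ^ 2 + ‖v - L.starProjection v‖ ^ 2)) ≤
      2 * (inner ℂ (v - K.starProjection v) (v - L.starProjection v)).re := by
  -- Removing the component in `K ⊓ L` changes neither `v - P_K v` nor `v - P_L v`, and makes the
  -- angle hypothesis applicable to the projections of `u`.
  set e := (K ⊓ L).starProjection v with he
  have heK : e ∈ K := (Submodule.starProjection_apply_mem (K ⊓ L) v).1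
  have heL : e ∈ L := (Submodule.starProjection_apply_mem (K ⊓ L) v).2
  have hPe : K.starProjection e = e := Submodule.starProjection_eq_self_iff.2 heK
  have hQe : L.starProjection e = e := Submodule.starProjection_eq_self_iff.2 heL
  set u := v - e with hu
  set x := K.starProjection u with hx
  set y := L.starProjection u with hy
  have h1 : v - K.starProjection v = u - x := by
    rw [hx, hu, map_sub, hPe]; abel
  have h2 : v - L.starProjection v = u - y := by
    rw [hy, hu, map_sub, hQe]; abel
  have hxK : x ∈ K := Submodule.starProjection_apply_mem K u
  have hyL : y ∈ L := Submodule.starProjection_apply_mem L u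
  have hux : (inner ℂ u x).re = ‖x‖ ^ 2 := by
    have := Submodule.starProjection_inner_eq_zero (K := K) u x hxK
    rw [inner_sub_left, sub_eq_zero] at this
    rw [this, inner_self_eq_norm_sq_to_K]
    norm_cast
  have huy : (inner ℂ u y).re = ‖y‖ ^ 2 := by
    have := Submodule.starProjection_inner_eq_zero (K := L) u y hyL
    rw [inner_sub_left, sub_eq_zero] at this
    rw [this, inner_self_eq_norm_sq_to_K]
    norm_cast
  have huo : u ∈ (K ⊓ L)ᗮ := Submodule.sub_starProjection_mem_orthogonal v
  have hyo : y ∈ (K ⊓ L)ᗮ := by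
    rw [Submodule.mem_orthogonal]
    intro z hz
    rw [hy, ← Submodule.inner_starProjection_left_eq_right,
      Submodule.starProjection_eq_self_iff.2 hz.2]
    exact (Submodule.mem_orthogonal _ _).1 huo z hz
  have hxy : (inner ℂ x y).re ≤ ε * (‖x‖ * ‖y‖) := by
    have e1 : inner ℂ x y = inner ℂ x (K.starProjection y) := by
      rw [← Submodule.inner_starProjection_left_eq_right K x y,
        Submodule.starProjection_eq_self_iff.2 hxK]
    rw [e1]
    calc _ ≤ ‖x‖ * ‖K.starProjection y‖ := re_inner_le_norm (𝕜 := ℂ) _ _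
      _ ≤ ‖x‖ * (ε * ‖y‖) := by gcongr; exact h y hyL hyo
      _ = _ := by ring
  rw [h1, h2]
  have n1 : ‖u - x‖ ^ 2 = ‖u‖ ^ 2 - ‖x‖ ^ 2 := by
    have := norm_sub_sq (𝕜 := ℂ) u x
    simp only [RCLike.re_eq_complex_re] at this
    rw [this, hux]; ring
  have n2 : ‖u - y‖ ^ 2 = ‖u‖ ^ 2 - ‖y‖ ^ 2 := by
    have := norm_sub_sq (𝕜 := ℂ) u y
    simp only [RCLike.re_eq_complex_re] at this
    rw [this, huy]; ring
  have n3 : (inner ℂ (u - x) (u - y)).re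
      = ‖u‖ ^ 2 - ‖x‖ ^ 2 - ‖y‖ ^ 2 + (inner ℂ x y).re := by
    have : (inner ℂ x u).re = ‖x‖ ^ 2 := by
      rw [← hux]; exact inner_re_symm (𝕜 := ℂ) x u
    simp only [inner_sub_left, inner_sub_right, Complex.sub_re, this, huy,
      inner_self_eq_norm_sq_to_K, Complex.coe_algebraMap, ← Complex.ofReal_pow,
      Complex.ofReal_re]
    ring
  have n4 : ‖x + y‖ ^ 2 = ‖x‖ ^ 2 + ‖y‖ ^ 2 + 2 * (inner ℂ x y).re := by
    have := norm_add_sq (𝕜 := ℂ) x y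
    simp only [RCLike.re_eq_complex_re] at this
    rw [this]; ring
  -- Cauchy–Schwarz for `u` against `x + y`; the left side is `Re ⟪u, x + y⟫`.
  have n5 : ‖x‖ ^ 2 + ‖y‖ ^ 2 ≤ ‖u‖ * ‖x + y‖ := by
    have := re_inner_le_norm (𝕜 := ℂ) u (x + y)
    rw [inner_add_right, map_add] at this
    simp only [RCLike.re_eq_complex_re, hux, huy] at this
    exact this
  rw [n1, n2, n3]
  set r := (inner ℂ x y).re
  set s := ‖x‖ ^ 2 + ‖y‖ ^ 2 with hs
  have hs0 : 0 ≤ s := by positivity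
  have hr : 2 * r ≤ ε * s := by
    nlinarith [sq_nonneg (‖x‖ - ‖y‖)]
  have n6 : s ^ 2 ≤ ‖u‖ ^ 2 * (s + 2 * r) := by
    rw [← n4, ← mul_pow]
    exact pow_le_pow_left₀ hs0 n5 2
  have n7 : 0 ≤ s + 2 * r := by rw [← n4]; positivity
  rcases n7.eq_or_lt with h0 | h0
  · rw [← h0, mul_zero] at n6
    have : s = 0 := by nlinarith
    nlinarith [sq_nonneg ‖u‖]
  -- The goal amounts to `(2 + ε) s - 2 r ≤ 2 (1 + ε) ‖u‖²`. Multiplied by `s + 2 r > 0`, it follows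
  -- from `n6` once the product on the right below is nonnegative; the factor `s - 2 r` is so
  -- because `ε ≤ 1`.
  · have key : (2 * (1 + ε) * s ^ 2 - ((2 + ε) * s - 2 * r) * (s + 2 * r)) =
      (s - 2 * r) * (ε * s - 2 * r) := by ring
    have h8 : 0 ≤ (s - 2 * r) * (ε * s - 2 * r) :=
      mul_nonneg (by nlinarith) (by linarith)
    have h9 : ((2 + ε) * s - 2 * r) * (s + 2 * r) ≤ 2 * (1 + ε) * ‖u‖ ^ 2 * (s + 2 * r) := by
      nlinarith
    have h10 := le_of_mul_le_mul_right h9 h0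
    nlinarith

/-- If `T` is positive and `T ^ 2 ≥ c T`, then `T ≥ c` on the orthogonal complement of `ker T`. -/
theorem le_re_inner_of_sq_ge [CompleteSpace V] (T : V →L[ℂ] V) (hT : 0 ≤ T) {c : ℝ}
    (h : ∀ v, c * (inner ℂ (T v) v).re ≤ ‖T v‖ ^ 2) (hker : ∀ v, T v = 0 → v = 0) (v : V) :
    c * ‖v‖ ^ 2 ≤ (inner ℂ (T v) v).re := by
  set S := CFC.sqrt T with hS
  have hSS : S * S = T := CFC.sqrt_mul_sqrt_self T
  have hSpos : S.IsPositive := (ContinuousLinearMap.nonneg_iff_isPositive S).1 (CFC.sqrt_nonneg T)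
  have hSsym : ∀ x y, inner ℂ (S x) y = inner ℂ x (S y) := hSpos.isSelfAdjoint.isSymmetric
  have hTS : ∀ x, T x = S (S x) := fun x => by rw [← hSS]; rfl
  have hinner : ∀ x, (inner ℂ (T x) x).re = ‖S x‖ ^ 2 := fun x => by
    rw [hTS, hSsym, inner_self_eq_norm_sq_to_K]; norm_cast
  have hdense : Dense (Set.range S) := by
    have : (S.range : Submodule ℂ V)ᗮ = ⊥ := by
      rw [Submodule.eq_bot_iff]
      intro x hx
      apply hker
      rw [hTS]
      have : S x = 0 := by
        rw [← inner_self_eq_zero (𝕜 := ℂ)]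
        rw [hSsym]
        rw [← inner_conj_symm]
        rw [(Submodule.mem_orthogonal _ _).1 hx (S (S x)) ⟨_, rfl⟩, map_zero]
      rw [this, map_zero]
    have h2 := (Submodule.topologicalClosure_eq_top_iff (K := (S.range : Submodule ℂ V))).2 this
    have h3 := (Submodule.dense_iff_topologicalClosure_eq_top (s := (S.range : Submodule ℂ V))).2 h2
    exact fun x => h3 x
  have hcont : Continuous fun x : V => (inner ℂ (T x) x).re - c * ‖x‖ ^ 2 := by fun_prop
  have hcl : IsClosed {x : V | 0 ≤ (inner ℂ (T x) x).re - c * ‖x‖ ^ 2} :=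
    isClosed_le continuous_const hcont
  have : v ∈ {x : V | 0 ≤ (inner ℂ (T x) x).re - c * ‖x‖ ^ 2} := by
    refine hcl.closure_subset_iff.2 ?_ (hdense v)
    rintro _ ⟨u, rfl⟩
    have := h u
    rw [hinner] at this
    change 0 ≤ (inner ℂ (T (S u)) (S u)).re - c * ‖S u‖ ^ 2
    rw [hinner, ← hTS]
    linarith
  change 0 ≤ (inner ℂ (T v) v).re - c * ‖v‖ ^ 2 at this
  linarith

/-- A quantitative bound for arrangements of subspaces whose pairwise angles are bounded below. -/
theorem sum_norm_sub_starProjection_sq_ge [CompleteSpace V] {d : ℕ} (K : Fin d → Submodule ℂ V)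
    [∀ i, (K i).HasOrthogonalProjection] {ε : ℝ}
    (h : ∀ i j, i < j → ∀ v, -(ε * (‖v - (K i).starProjection v‖ ^ 2 +
      ‖v - (K j).starProjection v‖ ^ 2)) ≤
      2 * (inner ℂ (v - (K i).starProjection v) (v - (K j).starProjection v)).re)
    (hK : ∀ v, (∀ i, v ∈ K i) → v = 0) (v : V) :
    (1 - ((d : ℝ) - 1) * ε) * ‖v‖ ^ 2 ≤ ∑ i, ‖v - (K i).starProjection v‖ ^ 2 := by
  set p : Fin d → V →L[ℂ] V := fun i => (K i)ᗮ.starProjection with hp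
  have hpv : ∀ i v, p i v = v - (K i).starProjection v := fun i v =>
    Submodule.starProjection_orthogonal_val v
  have hpp : ∀ i v, (inner ℂ (p i v) v).re = ‖p i v‖ ^ 2 := fun i v =>
    Submodule.re_inner_starProjection_eq_normSq (K i)ᗮ v
  set T : V →L[ℂ] V := ∑ i, p i with hT
  have hTv : ∀ v, T v = ∑ i, p i v := fun v => by simp [hT]
  have hTin : ∀ v, (inner ℂ (T v) v).re = ∑ i, ‖p i v‖ ^ 2 := fun v => by
    rw [hTv, sum_inner, Complex.re_sum]
    exact Finset.sum_congr rfl fun i _ => hpp i v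
  have hpos : 0 ≤ T := by
    rw [hT]
    refine Finset.sum_nonneg fun i _ => ?_
    rw [ContinuousLinearMap.nonneg_iff_isPositive]
    exact ContinuousLinearMap.IsPositive.of_isStarProjection isStarProjection_starProjection
  have hsq : ∀ v, (1 - ((d : ℝ) - 1) * ε) * (inner ℂ (T v) v).re ≤ ‖T v‖ ^ 2 := by
    intro v
    have e1 : ‖T v‖ ^ 2 = ∑ i, ∑ j, (inner ℂ (p i v) (p j v)).re := by
      rw [← inner_self_eq_norm_sq (𝕜 := ℂ), hTv, sum_inner]
      simp only [inner_sum, RCLike.re_eq_complex_re, Complex.re_sum]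
    have key : ∀ i j, i ≠ j → -(ε * (‖p i v‖ ^ 2 + ‖p j v‖ ^ 2)) / 2 ≤
        (inner ℂ (p i v) (p j v)).re := by
      intro i j hij
      rcases lt_or_gt_of_ne hij with hlt | hlt
      · have := h i j hlt v
        rw [← hpv, ← hpv] at this
        linarith
      · have := h j i hlt v
        rw [← hpv, ← hpv] at this
        have e2 : (inner ℂ (p i v) (p j v)).re = (inner ℂ (p j v) (p i v)).re :=
          inner_re_symm (𝕜 := ℂ) _ _
        rw [e2]
        linarith
    -- The diagonal receives an extra `ε ‖p i v‖²` so that one formula covers all pairs; after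
    -- summation each index has lost `d ε` and regained `ε`.
    have key2 : ∀ i j, (if i = j then (1 + ε) * ‖p i v‖ ^ 2 else 0) -
        ε * (‖p i v‖ ^ 2 + ‖p j v‖ ^ 2) / 2 ≤ (inner ℂ (p i v) (p j v)).re := by
      intro i j
      split_ifs with hij
      · subst hij
        have : (inner ℂ (p i v) (p i v)).re = ‖p i v‖ ^ 2 := inner_self_eq_norm_sq (𝕜 := ℂ) _
        linarith
      · have := key i j hij
        linarith
    have e3 : ∑ i, ∑ j, ((if i = j then (1 + ε) * ‖p i v‖ ^ 2 else 0) -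
        ε * (‖p i v‖ ^ 2 + ‖p j v‖ ^ 2) / 2) = (1 - ((d : ℝ) - 1) * ε) * ∑ i, ‖p i v‖ ^ 2 := by
      simp only [Finset.sum_sub_distrib, Finset.sum_ite_eq, Finset.mem_univ, if_true,
        ← Finset.mul_sum, ← Finset.sum_div, Finset.sum_add_distrib, Finset.sum_const,
        Finset.card_univ, Fintype.card_fin, nsmul_eq_mul]
      ring
    rw [hTin, e1, ← e3]
    exact Finset.sum_le_sum fun i _ => Finset.sum_le_sum fun j _ => key2 i j
  have hker : ∀ v, T v = 0 → v = 0 := by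
    intro v hv
    apply hK
    intro i
    have h0 : ∑ i, ‖p i v‖ ^ 2 = 0 := by rw [← hTin, hv]; simp
    have h1 := (Finset.sum_eq_zero_iff_of_nonneg (fun i _ => by positivity)).1 h0 i
      (Finset.mem_univ i)
    have h2 : p i v = 0 := by simpa using h1
    rw [hpv, sub_eq_zero] at h2
    exact Submodule.starProjection_eq_self_iff.1 h2.symm
  have := le_re_inner_of_sq_ge T hpos hsq hker v
  rw [hTin] at this
  simpa only [hpv] using this

end Subspaces

/-! ### Fixed vectors of a unitary representation. -/

namespace UnitaryRep

variable {G : Type*} [Group G] {V : Type*} [NormedAddCommGroup V] [InnerProductSpace ℂ V]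

/-- The vectors fixed by all elements of `S`. -/
def fixed (π : UnitaryRep G V) (S : Set G) : Submodule ℂ V where
  carrier := {v | ∀ s ∈ S, π s v = v}
  add_mem' {a b} ha hb s hs := by rw [map_add, ha s hs, hb s hs]
  zero_mem' s _ := map_zero _
  smul_mem' c v hv s hs := by rw [map_smul, hv s hs]

theorem mem_fixed {π : UnitaryRep G V} {S : Set G} {v : V} :
    v ∈ π.fixed S ↔ ∀ s ∈ S, π s v = v := Iff.rfl

theorem isClosed_fixed (π : UnitaryRep G V) (S : Set G) : IsClosed (π.fixed S : Set V) := by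
  have : (π.fixed S : Set V) = ⋂ s ∈ S, {v | π s v = v} := by
    ext v; simp [mem_fixed]
  rw [this]
  exact isClosed_biInter fun s _ => isClosed_eq (π s).continuous continuous_id

instance [CompleteSpace V] (π : UnitaryRep G V) (S : Set G) : CompleteSpace (π.fixed S) :=
  (π.isClosed_fixed S).isComplete.completeSpace_coe

theorem mul_apply (π : UnitaryRep G V) (g h : G) (v : V) : π (g * h) v = π g (π h v) := by
  rw [map_mul]; rfl

theorem inv_apply_eq (π : UnitaryRep G V) {g : G} {v : V} (h : π g v = v) : π g⁻¹ v = v := by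
  conv_lhs => rw [← h]
  rw [← mul_apply, inv_mul_cancel, map_one]; rfl

theorem inner_apply (π : UnitaryRep G V) (g : G) (v w : V) :
    inner ℂ (π g v) w = inner ℂ v (π g⁻¹ w) := by
  rw [← (π g).inner_map_map v, ← mul_apply, mul_inv_cancel, map_one]; rfl

theorem apply_mem_fixed {π : UnitaryRep G V} {S : Set G} {g : G} (hg : ∀ s ∈ S, Commute g s)
    {v : V} (hv : v ∈ π.fixed S) : π g v ∈ π.fixed S := fun s hs => by
  rw [← mul_apply, ← (hg s hs).eq, mul_apply, hv s hs]

theorem apply_mem_fixed_orthogonal {π : UnitaryRep G V} {S : Set G} {g : G}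
    (hg : ∀ s ∈ S, Commute g s) {v : V} (hv : v ∈ (π.fixed S)ᗮ) : π g v ∈ (π.fixed S)ᗮ := by
  rw [Submodule.mem_orthogonal'] at hv ⊢
  intro u hu
  rw [inner_apply]
  exact hv _ (apply_mem_fixed (fun s hs => (hg s hs).inv_left) hu)

variable [CompleteSpace V]

/-- The orthogonal projection onto the vectors fixed by `S`. -/
noncomputable abbrev proj (π : UnitaryRep G V) (S : Set G) : V →L[ℂ] V :=
  (π.fixed S).starProjection

theorem proj_mem (π : UnitaryRep G V) (S : Set G) (v : V) : π.proj S v ∈ π.fixed S :=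
  Submodule.starProjection_apply_mem _ v

theorem proj_eq_self_iff {π : UnitaryRep G V} {S : Set G} {v : V} :
    π.proj S v = v ↔ v ∈ π.fixed S :=
  Submodule.starProjection_eq_self_iff

theorem inner_proj_left (π : UnitaryRep G V) (S : Set G) (v w : V) :
    inner ℂ (π.proj S v) w = inner ℂ v (π.proj S w) :=
  Submodule.inner_starProjection_left_eq_right _ v w

theorem proj_apply_of_commute (π : UnitaryRep G V) {S : Set G} {g : G}
    (hg : ∀ s ∈ S, Commute g s) (v : V) : π.proj S (π g v) = π g (π.proj S v) := by
  apply Submodule.eq_starProjection_of_mem_orthogonal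
  · exact apply_mem_fixed hg (proj_mem π S v)
  · rw [← map_sub]
    exact apply_mem_fixed_orthogonal hg (Submodule.sub_starProjection_mem_orthogonal v)

theorem proj_mem_fixed_of_commute (π : UnitaryRep G V) {S S' : Set G}
    (h : ∀ s ∈ S, ∀ s' ∈ S', Commute s s') {v : V} (hv : v ∈ π.fixed S) :
    π.proj S' v ∈ π.fixed S := fun s hs => by
  rw [← proj_apply_of_commute π (h s hs), hv s hs]

theorem proj_comm (π : UnitaryRep G V) {S S' : Set G}
    (h : ∀ s ∈ S, ∀ s' ∈ S', Commute s s') (v : V) :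
    π.proj S (π.proj S' v) = π.proj S' (π.proj S v) := by
  apply Submodule.eq_starProjection_of_mem_orthogonal
  · exact proj_mem_fixed_of_commute π h (proj_mem π S v)
  · rw [← map_sub, Submodule.mem_orthogonal]
    intro u hu
    rw [← inner_proj_left]
    exact (Submodule.mem_orthogonal _ _).1 (Submodule.sub_starProjection_mem_orthogonal v) _
      (proj_mem_fixed_of_commute π h hu)

/-- Pairing with a fixed vector moves `g` to `g⁻¹`, which fixes that vector; so closure under
inverses suffices. -/
theorem proj_apply_of_mem (π : UnitaryRep G V) {S : Set G} (hinv : ∀ s ∈ S, s⁻¹ ∈ S) {g : G}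
    (hg : g ∈ S) (v : V) : π.proj S (π g v) = π.proj S v := by
  apply Submodule.eq_starProjection_of_mem_of_inner_eq_zero (proj_mem π S v)
  intro w hw
  have h1 : inner ℂ (π g v) w = inner ℂ v w := by
    rw [inner_apply, hw _ (hinv g hg)]
  rw [inner_sub_left, h1, ← inner_sub_left]
  exact Submodule.starProjection_inner_eq_zero v w hw

/-- A vector that is moved little by a subgroup is close to a fixed vector. -/
theorem two_mul_norm_sub_proj_sq_le (π : UnitaryRep G V) (H : Subgroup G) {δ : ℝ}
    {v : V} (h : ∀ g ∈ H, ‖π g v - v‖ ≤ δ) :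
    2 * ‖v - π.proj (H : Set G) v‖ ^ 2 ≤ δ ^ 2 := by
  set w := v - π.proj (H : Set G) v with hw
  have hwo : w ∈ (π.fixed (H : Set G))ᗮ := Submodule.sub_starProjection_mem_orthogonal v
  have hwd : ∀ g ∈ H, ‖π g w - w‖ ≤ δ := by
    intro g hg
    have : π g w - w = π g v - v := by
      rw [hw, map_sub, proj_mem π (H : Set G) v g hg]; abel
    rw [this]; exact h g hg
  by_contra! hlt
  have hδ : 0 ≤ δ := (norm_nonneg _).trans (h 1 H.one_mem)
  -- Unitarity gives `Re ⟪w, g w⟫ = ‖w‖² - ‖g w - w‖² / 2 ≥ η`: the orbit of `w` lies in a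
  -- half-space that avoids zero.
  set η := ‖w‖ ^ 2 - δ ^ 2 / 2 with hη
  have hη0 : 0 < η := by rw [hη]; linarith
  let : InnerProductSpace ℝ V := InnerProductSpace.rclikeToReal ℂ V
  have hre : ∀ a b : V, inner ℝ a b = (inner ℂ a b).re := fun a b => rfl
  set O : Set V := {x | ∃ g ∈ H, x = π g w} with hO
  set C := closure (convexHull ℝ O) with hC
  have hCconv : Convex ℝ C := (convex_convexHull ℝ O).closure
  have hwC : w ∈ C := subset_closure (subset_convexHull ℝ O ⟨1, H.one_mem, by rw [map_one]; rfl⟩)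
  have hClosed : IsClosed C := isClosed_closure
  have hCmin : ∀ s : Set V, IsClosed s → Convex ℝ s → O ⊆ s → C ⊆ s := fun s h1 h2 h3 =>
    closure_minimal (convexHull_min h3 h2) h1
  -- the convex set `C` is far from zero
  have hfar : ∀ x ∈ C, η ≤ inner ℝ w x := by
    refine hCmin {x | η ≤ inner ℝ w x} (isClosed_le continuous_const (by fun_prop)) ?_ ?_
    · exact convex_halfSpace_ge (innerₛₗ ℝ w).isLinear _
    · rintro _ ⟨g, hg, rfl⟩
      have h1 := norm_sub_sq_real (π g w) w
      have h2 : ‖π g w - w‖ ^ 2 ≤ δ ^ 2 := pow_le_pow_left₀ (norm_nonneg _) (hwd g hg) 2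
      rw [(π g).norm_map] at h1
      change η ≤ inner ℝ w (π g w)
      rw [real_inner_comm]
      linarith
  -- it is orthogonal to the invariant vectors
  have horth : ∀ x ∈ C, x ∈ (π.fixed (H : Set G))ᗮ := by
    refine hCmin ((π.fixed (H : Set G))ᗮ : Submodule ℂ V) (Submodule.isClosed_orthogonal _) ?_ ?_
    · exact ((π.fixed (H : Set G))ᗮ.restrictScalars ℝ).convex
    · rintro _ ⟨g, hg, rfl⟩
      rw [SetLike.mem_coe, Submodule.mem_orthogonal']
      intro u hu
      rw [inner_apply, hu _ (H.inv_mem hg)]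
      exact (Submodule.mem_orthogonal' _ _).1 hwo u hu
  -- it is invariant
  have hinv : ∀ g ∈ H, ∀ x ∈ C, π g x ∈ C := by
    intro g hg
    refine hCmin (π g ⁻¹' C) (hClosed.preimage (π g).continuous) ?_ ?_
    · exact hCconv.is_linear_preimage
        ((π g).toLinearEquiv.toLinearMap.restrictScalars ℝ).isLinear
    · rintro _ ⟨k, hk, rfl⟩
      exact subset_closure (subset_convexHull ℝ O ⟨g * k, H.mul_mem hg hk, by rw [mul_apply]⟩)
  -- The shortest vector `c` of the invariant set `C` is fixed: minimality gives `⟪c, g c⟫ ≥ ‖c‖²`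
  -- while `‖g c‖ = ‖c‖`. Being also orthogonal to the fixed vectors, it vanishes, against `hfar`.
  obtain ⟨c, hcC, hc⟩ := exists_norm_eq_iInf_of_complete_convex ⟨w, hwC⟩ hClosed.isComplete
    hCconv 0
  have hmin := (norm_eq_iInf_iff_real_inner_le_zero hCconv hcC).1 hc
  have hfix : c ∈ π.fixed (H : Set G) := by
    intro g hg
    have h1 := hmin _ (hinv g hg c hcC)
    rw [zero_sub, inner_neg_left, inner_sub_right, real_inner_self_eq_norm_sq] at h1
    have h2 := norm_sub_sq_real (π g c) c
    rw [(π g).norm_map, real_inner_comm] at h2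
    have h3 : ‖π g c - c‖ ^ 2 ≤ 0 := by linarith
    have h4 : ‖π g c - c‖ = 0 := by nlinarith [norm_nonneg (π g c - c)]
    exact sub_eq_zero.1 (norm_eq_zero.1 h4)
  have hc0 : c = 0 := by
    rw [← inner_self_eq_zero (𝕜 := ℂ)]
    exact (Submodule.mem_orthogonal _ _).1 (horth c hcC) c hfix
  have := hfar c hcC
  rw [hc0, inner_zero_right] at this
  linarith

end UnitaryRep

/-! ### Counting points of boxes, and commuting projections. -/

/-- A subgroup of large index meets a box in few points, uniformly in the subgroup. -/
theorem mul_card_box_le {A : Type*} [AddCommGroup A] {k : ℕ} (f : (Fin k → ℕ) →+ A)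
    (hf : Function.Surjective f) (K : AddSubgroup A) (N : ℕ) (hN : N ≤ K.index ∨ K.index = 0)
    (n : ℕ) (c : A) (s : Finset (Fin k → Fin n))
    (hs : ∀ p ∈ s, f (fun i => (p i : ℕ)) - c ∈ K) :
    N * s.card ≤ (n + N) ^ k := by
  classical
  rcases Nat.eq_zero_or_pos N with rfl | hNpos
  · simp
  let q : (Fin k → ℕ) → A ⧸ K := fun t => QuotientAddGroup.mk (f t)
  have hq : Function.Surjective q := (QuotientAddGroup.mk_surjective).comp hf
  -- `B r` is the ball of radius `r` in the quotient. A ball that does not grow in one step is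
  -- already everything (`hstab`), so `B r` either is everything or has at least `r + 1` points
  -- (`hgrow`).
  let B : ℕ → Set (A ⧸ K) := fun r => {x | ∃ t, ∑ i, t i ≤ r ∧ q t = x}
  have hBmono : ∀ r, B r ⊆ B (r + 1) := fun r x ⟨t, ht, hx⟩ => ⟨t, by omega, hx⟩
  have hstab : ∀ r, B (r + 1) ⊆ B r → ∀ x, x ∈ B r := by
    intro r hr
    have : ∀ m t, ∑ i, t i ≤ m → q t ∈ B r := by
      intro m
      induction m with
      | zero =>
        intro t ht
        exact ⟨t, by omega, rfl⟩
      | succ m ih =>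
        intro t ht
        by_cases h0 : ∀ i, t i = 0
        · exact ⟨t, by simp [h0], rfl⟩
        push Not at h0
        obtain ⟨i, hi⟩ := h0
        have hdec : t = (t - Pi.single i 1) + Pi.single i 1 := by
          funext j
          by_cases hj : j = i
          · subst hj; simp; omega
          · simp [hj]
        have hsum : ∑ j, t j = ∑ j, (t - Pi.single i 1 : Fin k → ℕ) j + 1 := by
          conv_lhs => rw [hdec]
          simp [Finset.sum_add_distrib]
        obtain ⟨t', ht', hx⟩ := ih (t - Pi.single i 1) (by omega)
        apply hr
        refine ⟨t' + Pi.single i 1, ?_, ?_⟩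
        · simp [Finset.sum_add_distrib]; omega
        · have e1 : ∀ t t', q (t + t') = q t + q t' := fun t t' => by
            simp only [q, map_add]; rfl
          conv_rhs => rw [hdec]
          rw [e1, e1, hx]
    intro x
    obtain ⟨t, rfl⟩ := hq x
    exact this _ t le_rfl
  have hgrow : ∀ r, (∀ x, x ∈ B r) ∨ ∃ s : Finset (A ⧸ K), (s : Set (A ⧸ K)) ⊆ B r ∧
      s.card = r + 1 := by
    intro r
    induction r with
    | zero =>
      right
      exact ⟨{q 0}, by simpa using ⟨0, by simp, rfl⟩, by simp⟩
    | succ r ih =>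
      rcases ih with ih | ⟨s, hsB, hsc⟩
      · exact Or.inl fun x => hBmono r (ih x)
      · by_cases h : B (r + 1) ⊆ s
        · exact Or.inl fun x => hBmono r (hstab r (h.trans hsB) x)
        · rw [Set.not_subset] at h
          obtain ⟨x, hx, hxs⟩ := h
          refine Or.inr ⟨insert x s, ?_, ?_⟩
          · rw [Finset.coe_insert]
            exact Set.insert_subset hx (hsB.trans (hBmono r))
          · rw [Finset.card_insert_of_notMem hxs, hsc]
  have hex : ∃ s : Finset (A ⧸ K), (s : Set (A ⧸ K)) ⊆ B (N - 1) ∧ s.card = N := by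
    rcases hgrow (N - 1) with h | ⟨s, h1, h2⟩
    -- Here the quotient is a finite ball, which rules out `K.index = 0`, the encoding of infinite
    -- index.
    · have hfin : Finite (A ⧸ K) := by
        have hBfin : (B (N - 1)).Finite := by
          refine ((Set.Finite.pi' (t := fun _ : Fin k => Set.Iic (N - 1))
            (fun _ => Set.finite_Iic _)).image q).subset ?_
          rintro _ ⟨t, ht, rfl⟩
          exact ⟨t, fun i => (Finset.single_le_sum (fun _ _ => Nat.zero_le _)
            (Finset.mem_univ i)).trans ht, rfl⟩
        exact Set.finite_univ_iff.1 (hBfin.subset fun x _ => h x)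
      have hidx : K.index ≠ 0 := AddSubgroup.index_ne_zero_of_finite
      have hle : N ≤ K.index := hN.resolve_right hidx
      have := Fintype.ofFinite (A ⧸ K)
      rw [AddSubgroup.index, Nat.card_eq_fintype_card] at hle
      obtain ⟨s, hs1, hs2⟩ := Finset.exists_subset_card_eq (s := Finset.univ) hle
      exact ⟨s, fun x _ => h x, hs2⟩
    · exact ⟨s, h1, by omega⟩
  obtain ⟨u, huB, huc⟩ := hex
  have huB' : ∀ x ∈ u, ∃ t : Fin k → ℕ, ∑ i, t i ≤ N - 1 ∧ q t = x := fun x hx => huB hx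
  choose! τ hτ1 hτ2 using huB'
  -- Translates of `s` by short representatives of `N` distinct cosets are disjoint, because `s`
  -- lies over a single coset, and they fit into a box of side `n + N`.
  have hcard : (u ×ˢ s).card ≤ (Fintype.piFinset fun _ : Fin k => Finset.range (n + N)).card := by
    refine Finset.card_le_card_of_injOn (fun z i => (z.2 i : ℕ) + τ z.1 i) ?_ ?_
    · rintro ⟨x, p⟩ hz
      rw [Finset.mem_coe, Finset.mem_product] at hz
      rw [Finset.mem_coe, Fintype.mem_piFinset]
      intro i
      rw [Finset.mem_range]
      have h1 : ∑ j, τ x j ≤ N - 1 := hτ1 _ hz.1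
      have h2 : τ x i ≤ ∑ j, τ x j :=
        Finset.single_le_sum (f := τ x) (fun _ _ => Nat.zero_le _) (Finset.mem_univ i)
      have h3 := (p i).2
      change (p i : ℕ) + τ x i < n + N
      omega
    · rintro ⟨x, p⟩ hz ⟨x', p'⟩ hz' heq
      rw [Finset.mem_coe, Finset.mem_product] at hz hz'
      have heq' : (fun i => (p i : ℕ)) + τ x = (fun i => (p' i : ℕ)) + τ x' := heq
      have hxx : x = x' := by
        have hmk : ∀ p ∈ s, q (fun i => (p i : ℕ)) = (QuotientAddGroup.mk c : A ⧸ K) := by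
          intro p hp
          exact (QuotientAddGroup.eq_iff_sub_mem).2 (hs p hp)
        have h1 := congrArg q heq'
        have e1 : ∀ t t', q (t + t') = q t + q t' := fun t t' => by
          simp only [q, map_add]; rfl
        rw [e1, e1, hmk p hz.2, hmk p' hz'.2, hτ2 _ hz.1, hτ2 _ hz'.1] at h1
        exact add_left_cancel h1
      subst hxx
      have := add_right_cancel heq'
      congr 1
      funext i
      exact Fin.ext (congrFun this i)
  rw [Finset.card_product, huc] at hcard
  simpa using hcard

/-- A sum of norms of commuting projections can be estimated on joint eigenvectors. -/
theorem sum_norm_sq_le_of_commuting {V : Type*} [NormedAddCommGroup V] [InnerProductSpace ℂ V]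
    {J : Type*} [Fintype J] (Q : J → V →L[ℂ] V) (hidem : ∀ j v, Q j (Q j v) = Q j v)
    (hsymm : ∀ j v w, inner ℂ (Q j v) w = inner ℂ v (Q j w))
    (hcomm : ∀ i j v, Q i (Q j v) = Q j (Q i v)) (W : Submodule ℂ V)
    (hW : ∀ j, ∀ w ∈ W, Q j w ∈ W) (C : ℝ)
    (h : ∀ w ∈ W, (∀ j, Q j w = w ∨ Q j w = 0) → ∑ j, ‖Q j w‖ ^ 2 ≤ C * ‖w‖ ^ 2)
    (v : V) (hv : v ∈ W) : ∑ j, ‖Q j v‖ ^ 2 ≤ C * ‖v‖ ^ 2 := by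
  classical
  have pyth : ∀ j u, ‖u‖ ^ 2 = ‖Q j u‖ ^ 2 + ‖u - Q j u‖ ^ 2 := by
    intro j u
    have h0 : inner ℂ (Q j u) (u - Q j u) = 0 := by
      rw [hsymm, map_sub, hidem, sub_self, inner_zero_right]
    have := norm_add_sq_eq_norm_sq_add_norm_sq_of_inner_eq_zero (Q j u) (u - Q j u) h0
    rw [add_sub_cancel] at this
    simpa [sq] using this
  -- `D` contains the indices for which `v` need not be an eigenvector. Splitting `v` into `Q i v`
  -- and `v - Q i v` removes `i` from `D`, and both sides of the inequality are additive under this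
  -- splitting by Pythagoras and commutativity.
  have main : ∀ D : Finset J, ∀ v ∈ W, (∀ j ∉ D, Q j v = v ∨ Q j v = 0) →
      ∑ j, ‖Q j v‖ ^ 2 ≤ C * ‖v‖ ^ 2 := by
    intro D
    induction D using Finset.induction_on with
    | empty => exact fun v hv hd => h v hv fun j => hd j (Finset.notMem_empty j)
    | insert i D _ ih =>
      intro v hv hd
      have h1 := ih (Q i v) (hW i v hv) (by
        intro j hj
        by_cases hji : j = i
        · subst hji; exact Or.inl (hidem _ _)
        · rw [hcomm]
          rcases hd j (by simp [hj, hji]) with e | e <;> rw [e]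
          · exact Or.inl rfl
          · exact Or.inr (map_zero _))
      have h2 := ih (v - Q i v) (W.sub_mem hv (hW i v hv)) (by
        intro j hj
        by_cases hji : j = i
        · subst hji; right; rw [map_sub, hidem, sub_self]
        · rw [map_sub, hcomm]
          rcases hd j (by simp [hj, hji]) with e | e <;> rw [e]
          · exact Or.inl rfl
          · right; rw [map_zero, sub_zero])
      rw [pyth i v, mul_add]
      calc ∑ j, ‖Q j v‖ ^ 2 = ∑ j, ‖Q j (Q i v)‖ ^ 2 + ∑ j, ‖Q j (v - Q i v)‖ ^ 2 := by
            rw [← Finset.sum_add_distrib]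
            refine Finset.sum_congr rfl fun j _ => ?_
            rw [pyth i (Q j v), map_sub, hcomm j i]
        _ ≤ _ := add_le_add h1 h2
  exact main Finset.univ v hv fun j hj => absurd (Finset.mem_univ j) hj

/-- Enlarging the side of a box by a fixed amount does not change its volume asymptotically: `((n +
N) / n) ^ k → 1`. -/
theorem le_of_forall_pow_mul_le {k N : ℕ} {s t : ℝ}
    (h : ∀ n : ℕ, 0 < n → (n : ℝ) ^ k * t ≤ ((n : ℝ) + N) ^ k * s) : t ≤ s := by
  have hlim : Filter.Tendsto (fun n : ℕ => (1 + (N : ℝ) / n) ^ k * s) Filter.atTop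
      (nhds ((1 + 0) ^ k * s)) :=
    ((tendsto_const_nhds.add (tendsto_const_div_atTop_nhds_zero_nat _)).pow k).mul_const s
  rw [add_zero, one_pow, one_mul] at hlim
  refine ge_of_tendsto hlim (Filter.eventually_atTop.2 ⟨1, fun n hn => ?_⟩)
  have hn0 : (0 : ℝ) < n := by exact_mod_cast hn
  have h1 := h n hn
  have h2 : ((n : ℝ) + N) = n * (1 + N / n) := by field_simp
  rw [h2, mul_pow, mul_assoc] at h1
  exact le_of_mul_le_mul_left h1 (by positivity)

/-! ### The angle between two families with central commutators. -/

/-- Additive families of group elements with central commutators. -/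
structure CentralPair {G A B : Type*} [Group G] [AddCommGroup A] [AddCommGroup B]
    (a : A → G) (b : B → G) : Prop where
  map_add_left : ∀ x x', a (x + x') = a x * a x'
  map_add_right : ∀ y y', b (y + y') = b y * b y'
  comm_left : ∀ x y x', Commute ⁅a x, b y⁆ (a x')
  comm_right : ∀ x y y', Commute ⁅a x, b y⁆ (b y')

theorem map_zero_of_map_add {G A : Type*} [Group G] [AddCommGroup A] {a : A → G}
    (ha : ∀ x x', a (x + x') = a x * a x') : a 0 = 1 := by
  have := ha 0 0
  rwa [add_zero, left_eq_mul] at this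

theorem map_neg_of_map_add {G A : Type*} [Group G] [AddCommGroup A] {a : A → G}
    (ha : ∀ x x', a (x + x') = a x * a x') (x : A) : a (-x) = (a x)⁻¹ := by
  rw [eq_inv_iff_mul_eq_one, ← ha, neg_add_cancel, map_zero_of_map_add ha]

namespace CentralPair

variable {G A B : Type*} [Group G] [AddCommGroup A] [AddCommGroup B] {a : A → G} {b : B → G}

theorem commutator_add (h : CentralPair a b) (x x' : A) (y : B) :
    ⁅a (x + x'), b y⁆ = ⁅a x, b y⁆ * ⁅a x', b y⁆ := by
  have h1 : ⁅a (x + x'), b y⁆ = a x * ⁅a x', b y⁆ * b y * (a x)⁻¹ * (b y)⁻¹ := by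
    rw [h.map_add_left]; simp only [commutatorElement_def]; group
  rw [h1, ← (h.comm_left x' y x).eq]
  have h2 : ⁅a x', b y⁆ * a x * b y * (a x)⁻¹ * (b y)⁻¹ = ⁅a x', b y⁆ * ⁅a x, b y⁆ := by
    simp only [commutatorElement_def]; group
  rw [h2]
  have h3 : Commute ⁅a x', b y⁆ ⁅a x, b y⁆ := by
    rw [commutatorElement_def (a x)]
    exact (((h.comm_left x' y x).mul_right (h.comm_right x' y y)).mul_right
      (h.comm_left x' y x).inv_right).mul_right (h.comm_right x' y y).inv_right
  exact h3.eq

theorem commute_commutator (h : CentralPair a b) (x x' : A) (y y' : B) :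
    Commute ⁅a x, b y⁆ ⁅a x', b y'⁆ := by
  rw [commutatorElement_def (a x')]
  exact (((h.comm_left x y x').mul_right (h.comm_right x y y')).mul_right
    (h.comm_left x y x').inv_right).mul_right (h.comm_right x y y').inv_right

variable {V : Type*} [NormedAddCommGroup V] [InnerProductSpace ℂ V]

/-- The elements of `A` whose commutators with all `b y` fix `w`. -/
def stab (h : CentralPair a b) (π : UnitaryRep G V) (w : V) : AddSubgroup A where
  carrier := {x | ∀ y, π ⁅a x, b y⁆ w = w}
  zero_mem' y := by
    rw [map_zero_of_map_add h.map_add_left, commutatorElement_one_left, map_one]; rfl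
  add_mem' {x x'} hx hx' y := by
    rw [h.commutator_add, π.mul_apply, hx' y, hx y]
  neg_mem' {x} hx y := by
    have h1 : ⁅a (-x), b y⁆ = ⁅a x, b y⁆⁻¹ := by
      rw [eq_inv_iff_mul_eq_one, ← h.commutator_add, neg_add_cancel,
        map_zero_of_map_add h.map_add_left, commutatorElement_one_left]
    rw [h1]
    exact π.inv_apply_eq (hx y)

theorem mem_stab {h : CentralPair a b} {π : UnitaryRep G V} {w : V} {x : A} :
    x ∈ h.stab π w ↔ w ∈ π.fixed (Set.range fun y => ⁅a x, b y⁆) := by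
  rw [UnitaryRep.mem_fixed, Set.forall_mem_range]; rfl

/-- The condition that proper subgroups of `A` that are compatible with the commutator pairing have
index at least `N`. -/
def IndexBound (a : A → G) (b : B → G) (N : ℕ) : Prop :=
  ∀ K : AddSubgroup A, (∀ x ∈ K, ∀ x', (∀ y, ∃ y', ⁅a x', b y⁆ = ⁅a x, b y'⁆) → x' ∈ K) →
    K ≠ ⊤ → N ≤ K.index ∨ K.index = 0

variable [CompleteSpace V]

/-- Since `⁅a x, b y⁆⁻¹ * a x = b y * a x * (b y)⁻¹` and `v` is fixed by `b`, the projection of `a x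
v` to the `b`-fixed vectors is fixed by every `⁅a x, b y⁆`. Hence the coefficient does not change
when `v` is replaced by its part fixed by these commutators. -/
theorem re_inner_apply_le (h : CentralPair a b) (π : UnitaryRep G V) {v : V}
    (hv : v ∈ π.fixed (Set.range b)) (x : A) :
    (inner ℂ (π (a x) v) v).re ≤ ‖π.proj (Set.range fun y => ⁅a x, b y⁆) v‖ ^ 2 := by
  set Z := Set.range fun y => ⁅a x, b y⁆ with hZ
  have hbinv : ∀ s ∈ Set.range b, s⁻¹ ∈ Set.range b := by
    rintro _ ⟨y, rfl⟩
    exact ⟨-y, map_neg_of_map_add h.map_add_right y⟩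
  have hZb : ∀ z ∈ Z, ∀ s ∈ Set.range b, Commute z s := by
    rintro _ ⟨y, rfl⟩ _ ⟨y', rfl⟩
    exact h.comm_right x y y'
  have hZa : ∀ z ∈ Z, Commute (a x) z := by
    rintro _ ⟨y, rfl⟩
    exact (h.comm_left x y x).symm
  set u := π.proj (Set.range b) (π (a x) v) with hu
  have huZ : u ∈ π.fixed Z := by
    rintro z hz
    have hzb := hZb z hz
    obtain ⟨y, rfl⟩ := hz
    suffices h1 : π ⁅a x, b y⁆⁻¹ u = u by
      have := π.inv_apply_eq h1
      rwa [inv_inv] at this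
    rw [hu, ← π.proj_apply_of_commute (fun s hs => (hzb s hs).inv_left), ← π.mul_apply]
    have e : ⁅a x, b y⁆⁻¹ * a x = b y * (a x * (b y)⁻¹) := by
      simp only [commutatorElement_def]; group
    rw [e, π.mul_apply, π.proj_apply_of_mem hbinv ⟨y, rfl⟩, π.mul_apply,
      hv _ (hbinv _ ⟨y, rfl⟩)]
  have hQv : π.proj Z v ∈ π.fixed (Set.range b) :=
    π.proj_mem_fixed_of_commute (fun s hs z hz => (hZb z hz s hs).symm) hv
  have key : inner ℂ (π (a x) v) v = inner ℂ (π (a x) (π.proj Z v)) (π.proj Z v) := by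
    calc inner ℂ (π (a x) v) v = inner ℂ (π (a x) v) (π.proj (Set.range b) v) := by
          rw [UnitaryRep.proj_eq_self_iff.2 hv]
      _ = inner ℂ (π.proj Z u) v := by
          rw [← π.inner_proj_left, UnitaryRep.proj_eq_self_iff.2 huZ]
      _ = inner ℂ (π (a x) v) (π.proj Z v) := by
          rw [π.inner_proj_left, hu, π.inner_proj_left, UnitaryRep.proj_eq_self_iff.2 hQv]
      _ = inner ℂ (π (a x) v) (π.proj Z (π.proj Z v)) := by
          rw [UnitaryRep.proj_eq_self_iff.2 (π.proj_mem Z v)]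
      _ = _ := by
          rw [← π.inner_proj_left, π.proj_apply_of_commute hZa]
  rw [key]
  calc _ ≤ ‖π (a x) (π.proj Z v)‖ * ‖π.proj Z v‖ := re_inner_le_norm (𝕜 := ℂ) _ _
    _ = _ := by rw [(π (a x)).norm_map, sq]

/-- The case with no vector component fixed by all commutators. Averaging `a` over boxes that are
images of `[0, n) ^ k` reduces the bound to counting differences in a proper subgroup; the error
from the boundary of the box disappears as `n → ∞`. -/
theorem mul_norm_proj_sq_le_of_proj_eq_zero [AddGroup.FG A] (h : CentralPair a b) {N : ℕ}
    (hN : IndexBound a b N) (π : UnitaryRep G V) {v : V}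
    (hv : v ∈ π.fixed (Set.range b))
    (hv0 : π.proj {g | ∃ x y, g = ⁅a x, b y⁆} v = 0) :
    N * ‖π.proj (Set.range a) v‖ ^ 2 ≤ ‖v‖ ^ 2 := by
  classical
  obtain ⟨k, f, hf⟩ : ∃ (k : ℕ) (f : (Fin k → ℕ) →+ A), Function.Surjective f := by
    have h1 : AddMonoid.FG A := AddGroup.fg_iff_addMonoid_fg.1 inferInstance
    obtain ⟨k, f, hf⟩ := AddSubmonoid.fg_iff_exists_fin_addMonoidHom.1 (AddMonoid.fg_def.1 h1)
    exact ⟨k, f, AddMonoidHom.mrange_eq_top.1 hf⟩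
  set Z : Set G := {g | ∃ x y, g = ⁅a x, b y⁆} with hZ
  have hainv : ∀ s ∈ Set.range a, s⁻¹ ∈ Set.range a := by
    rintro _ ⟨y, rfl⟩
    exact ⟨-y, map_neg_of_map_add h.map_add_left y⟩
  rcases Nat.eq_zero_or_pos N with rfl | hNpos
  · simp
  have hN0 : (0 : ℝ) < N := by exact_mod_cast hNpos
  apply le_of_forall_pow_mul_le (k := k) (N := N)
  intro n hn
  let X : (Fin k → Fin n) → A := fun p => f fun i => (p i : ℕ)
  -- These projections commute because all commutators commute with one another.
  let Q : (Fin k → Fin n) × (Fin k → Fin n) → V →L[ℂ] V := fun j =>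
    π.proj (Set.range fun y => ⁅a (X j.1 - X j.2), b y⁆)
  have hsum : ∑ j, ‖Q j v‖ ^ 2 ≤ ((n : ℝ) ^ k * ((n : ℝ) + N) ^ k / N) * ‖v‖ ^ 2 := by
    have hcomm : ∀ x x', ∀ s ∈ Set.range (fun y => ⁅a x, b y⁆),
        ∀ s' ∈ Set.range (fun y => ⁅a x', b y⁆), Commute s s' := by
      rintro x x' _ ⟨y, rfl⟩ _ ⟨y', rfl⟩
      exact h.commute_commutator x x' y y'
    have hcommZ : ∀ x, ∀ s ∈ Z, ∀ s' ∈ Set.range (fun y => ⁅a x, b y⁆), Commute s s' := by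
      rintro x _ ⟨x', y', rfl⟩ _ ⟨y, rfl⟩
      exact h.commute_commutator x' x y' y
    refine sum_norm_sq_le_of_commuting Q
      (fun j v => UnitaryRep.proj_eq_self_iff.2 (π.proj_mem _ v))
      (fun j v w => π.inner_proj_left _ v w) (fun i j v => π.proj_comm (hcomm _ _) v)
      (π.proj Z).ker (fun j w hw => ?_) _ (fun w hw hdec => ?_) v hv0
    · rw [LinearMap.mem_ker] at hw ⊢
      change π.proj Z (π.proj _ w) = 0
      rw [π.proj_comm (hcommZ _), show π.proj Z w = 0 from hw, map_zero]
    · have hw' : π.proj Z w = 0 := hw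
      by_cases hw0 : w = 0
      · subst hw0; simp
      have hmem : ∀ j, Q j w = w ↔ X j.1 - X j.2 ∈ h.stab π w := fun j => by
        rw [mem_stab, ← UnitaryRep.proj_eq_self_iff]
      -- `h.stab π w` is compatible with the pairing by its definition, and proper since `w ≠ 0` has
      -- no component fixed by all commutators.
      have hbound := hN (h.stab π w) (by
        intro x hx x' hx' y
        obtain ⟨y', hy'⟩ := hx' y
        rw [hy']; exact hx y') (by
        intro htop
        apply hw0
        rw [← hw', eq_comm, UnitaryRep.proj_eq_self_iff]
        rintro _ ⟨x, y, rfl⟩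
        have : x ∈ h.stab π w := by rw [htop]; trivial
        exact this y)
      have e1 : ∑ j, ‖Q j w‖ ^ 2 =
          ((Finset.univ.filter fun j : (Fin k → Fin n) × (Fin k → Fin n) =>
            X j.1 - X j.2 ∈ h.stab π w).card : ℝ) * ‖w‖ ^ 2 := by
        rw [← nsmul_eq_mul, ← Finset.sum_const, Finset.sum_filter]
        refine Finset.sum_congr rfl fun j _ => ?_
        split_ifs with hj
        · rw [(hmem j).2 hj]
        · rw [(hdec j).resolve_left (mt (hmem j).1 hj)]; simp
      have e2 : N * (Finset.univ.filter fun j : (Fin k → Fin n) × (Fin k → Fin n) =>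
          X j.1 - X j.2 ∈ h.stab π w).card ≤ n ^ k * (n + N) ^ k := by
        have : (Finset.univ.filter fun j : (Fin k → Fin n) × (Fin k → Fin n) =>
            X j.1 - X j.2 ∈ h.stab π w).card =
            ∑ q, (Finset.univ.filter fun p => X p - X q ∈ h.stab π w).card := by
          simp only [Finset.card_filter]
          rw [Fintype.sum_prod_type_right]
        rw [this, Finset.mul_sum]
        calc _ ≤ ∑ q : Fin k → Fin n, (n + N) ^ k := by
              refine Finset.sum_le_sum fun q _ => ?_
              exact mul_card_box_le f hf (h.stab π w) N hbound n (X q) _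
                fun p hp => (Finset.mem_filter.1 hp).2
          _ = _ := by
            rw [Finset.sum_const, Finset.card_univ, Fintype.card_fun, Fintype.card_fin,
              Fintype.card_fin, smul_eq_mul]
      rw [e1]
      refine mul_le_mul_of_nonneg_right ?_ (by positivity)
      rw [le_div_iff₀ hN0, mul_comm]
      exact_mod_cast e2
  -- All `a (X p) v` have the same projection to the `a`-fixed vectors; expanding the squared norm
  -- of their sum gives the coefficients of the differences `X p - X q`.
  have havg : ((n : ℝ) ^ k) ^ 2 * ‖π.proj (Set.range a) v‖ ^ 2 ≤ ∑ j, ‖Q j v‖ ^ 2 := by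
    have h1 : π.proj (Set.range a) (∑ p, π (a (X p)) v) = ((n : ℂ) ^ k) •
        π.proj (Set.range a) v := by
      rw [map_sum, Finset.sum_congr rfl fun p _ => π.proj_apply_of_mem hainv ⟨X p, rfl⟩ v]
      rw [Finset.sum_const, Finset.card_univ, Fintype.card_fun, Fintype.card_fin,
        Fintype.card_fin, ← Nat.cast_smul_eq_nsmul ℂ, Nat.cast_pow]
    have h2 : (n : ℝ) ^ k * ‖π.proj (Set.range a) v‖ ≤ ‖∑ p, π (a (X p)) v‖ := by
      calc _ = ‖((n : ℂ) ^ k) • π.proj (Set.range a) v‖ := by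
            rw [norm_smul, norm_pow, Complex.norm_natCast]
        _ ≤ _ := by
          rw [← h1]
          exact Submodule.norm_starProjection_apply_le _ _
    rw [← mul_pow]
    refine (pow_le_pow_left₀ (by positivity) h2 2).trans ?_
    rw [← inner_self_eq_norm_sq (𝕜 := ℂ), sum_inner, Fintype.sum_prod_type]
    simp only [inner_sum, RCLike.re_eq_complex_re, Complex.re_sum]
    refine Finset.sum_le_sum fun p _ => Finset.sum_le_sum fun q _ => ?_
    refine le_trans (le_of_eq ?_) (h.re_inner_apply_le π hv (X p - X q))
    have : a (X p - X q) = (a (X q))⁻¹ * a (X p) := by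
      rw [← map_neg_of_map_add h.map_add_left, ← h.map_add_left]; congr 1; abel
    rw [this, π.mul_apply, π.inner_apply _ (π (a (X p)) v), inv_inv]
  have hn0 : (0 : ℝ) < (n : ℝ) ^ k := by have : (0 : ℝ) < n := by exact_mod_cast hn
                                         positivity
  have h3 := havg.trans hsum
  rw [sq, mul_assoc, div_mul_eq_mul_div, mul_assoc, mul_div_assoc] at h3
  have h4 := le_of_mul_le_mul_left h3 hn0
  rw [le_div_iff₀ hN0] at h4
  linarith

/-- On the vectors fixed by all commutators the two families act as commuting ones, so projecting
the component `v₀` of `v` there to the `a`-fixed vectors lands in the common fixed space, to which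
`v` is orthogonal. Thus `v₀` contributes nothing and `v - v₀` falls under the previous case. -/
theorem mul_norm_proj_sq_le [AddGroup.FG A] (h : CentralPair a b) {N : ℕ}
    (hN : IndexBound a b N) (π : UnitaryRep G V) {v : V} (hv : v ∈ π.fixed (Set.range b))
    (hvo : v ∈ (π.fixed (Set.range a) ⊓ π.fixed (Set.range b))ᗮ) :
    N * ‖π.proj (Set.range a) v‖ ^ 2 ≤ ‖v‖ ^ 2 := by
  set Z : Set G := {g | ∃ x y, g = ⁅a x, b y⁆} with hZ
  have hZa : ∀ s ∈ Set.range a, ∀ z ∈ Z, Commute s z := by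
    rintro _ ⟨x', rfl⟩ _ ⟨x, y, rfl⟩
    exact (h.comm_left x y x').symm
  have hZb : ∀ s ∈ Set.range b, ∀ z ∈ Z, Commute s z := by
    rintro _ ⟨y', rfl⟩ _ ⟨x, y, rfl⟩
    exact (h.comm_right x y y').symm
  have hainv : ∀ s ∈ Set.range a, s⁻¹ ∈ Set.range a := by
    rintro _ ⟨y, rfl⟩
    exact ⟨-y, map_neg_of_map_add h.map_add_left y⟩
  set v₀ := π.proj Z v with hv₀
  have hv₀b : v₀ ∈ π.fixed (Set.range b) := π.proj_mem_fixed_of_commute hZb hv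
  have hv₀Z : v₀ ∈ π.fixed Z := π.proj_mem Z v
  set u := π.proj (Set.range a) v₀ with hu
  have huZ : u ∈ π.fixed Z :=
    π.proj_mem_fixed_of_commute (fun z hz s hs => (hZa s hs z hz).symm) hv₀Z
  have hua : u ∈ π.fixed (Set.range a) := π.proj_mem _ _
  have hbA : ∀ y, ∀ {w : V}, w ∈ π.fixed (Set.range a) → w ∈ π.fixed Z →
      π (b y) w ∈ π.fixed (Set.range a) := by
    rintro y w hwa hwZ _ ⟨x, rfl⟩
    have h1 : a x * b y = b y * a x * ⁅(a x)⁻¹, (b y)⁻¹⁆ := by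
      simp only [commutatorElement_def]; group
    have h2 : ⁅(a x)⁻¹, (b y)⁻¹⁆ ∈ Z :=
      ⟨-x, -y, by rw [map_neg_of_map_add h.map_add_left, map_neg_of_map_add h.map_add_right]⟩
    rw [← π.mul_apply, h1, π.mul_apply, hwZ _ h2, π.mul_apply, hwa _ ⟨x, rfl⟩]
  have hub : u ∈ π.fixed (Set.range b) := by
    rintro _ ⟨y, rfl⟩
    apply Eq.symm
    apply Submodule.eq_starProjection_of_mem_of_inner_eq_zero
    · exact hbA y hua huZ
    · intro w hw
      have hbuZ : π (b y) u ∈ π.fixed Z :=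
        UnitaryRep.apply_mem_fixed (hZb _ ⟨y, rfl⟩) huZ
      have hwa : π.proj Z w ∈ π.fixed (Set.range a) := π.proj_mem_fixed_of_commute hZa hw
      have hwZ : π.proj Z w ∈ π.fixed Z := π.proj_mem Z w
      rw [← UnitaryRep.proj_eq_self_iff.2 (Submodule.sub_mem _ hv₀Z hbuZ), π.inner_proj_left,
        inner_sub_left, sub_eq_zero, π.inner_apply, hu,
        π.inner_proj_left (Set.range a),
        ← map_neg_of_map_add h.map_add_right, UnitaryRep.proj_eq_self_iff.2 (hbA (-y) hwa hwZ),
        map_neg_of_map_add h.map_add_right, ← π.inner_apply, hv₀b _ ⟨y, rfl⟩]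
  have hu0 : u = 0 := by
    rw [← inner_self_eq_zero (𝕜 := ℂ)]
    calc inner ℂ u u = inner ℂ v₀ u := by
          conv_lhs => rw [hu]
          rw [π.inner_proj_left, UnitaryRep.proj_eq_self_iff.2 hua]
      _ = inner ℂ v u := by
          rw [hv₀, π.inner_proj_left, UnitaryRep.proj_eq_self_iff.2 huZ]
      _ = 0 := (Submodule.mem_orthogonal' _ _).1 hvo u ⟨hua, hub⟩
  have h1 : π.proj (Set.range a) v = π.proj (Set.range a) (v - v₀) := by
    rw [map_sub, ← hu, hu0, sub_zero]
  have h2 : ‖v - v₀‖ ≤ ‖v‖ := by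
    rw [hv₀, ← Submodule.starProjection_orthogonal_val]
    exact Submodule.norm_starProjection_apply_le _ _
  rw [h1]
  refine (h.mul_norm_proj_sq_le_of_proj_eq_zero hN π (Submodule.sub_mem _ hv hv₀b) ?_).trans
    (pow_le_pow_left₀ (norm_nonneg _) h2 2)
  rw [map_sub, sub_eq_zero, eq_comm]
  exact UnitaryRep.proj_eq_self_iff.2 hv₀Z

end CentralPair

/-! ### From pairwise angles to the Kazhdan constant. -/

theorem ENat.invSqrt_nonneg (m : ℕ∞) : 0 ≤ m.invSqrt := Real.sqrt_nonneg _

theorem ENat.invSqrt_top : (⊤ : ℕ∞).invSqrt = 0 := by simp [ENat.invSqrt]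

theorem ENat.invSqrt_coe (n : ℕ) : (n : ℕ∞).invSqrt = 1 / Real.sqrt n := by
  simp [ENat.invSqrt, ENNReal.toReal_inv]

theorem ENat.invSqrt_le_one (m : ℕ∞) (hm : 1 ≤ m) : m.invSqrt ≤ 1 := by
  cases m with
  | top => rw [ENat.invSqrt_top]; exact zero_le_one
  | coe n =>
    have hn : 1 ≤ n := by exact_mod_cast hm
    rw [ENat.invSqrt_coe, div_le_one (Real.sqrt_pos.2 (by exact_mod_cast hn)), Real.one_le_sqrt]
    exact_mod_cast hn

theorem ENat.one_sub_mul_invSqrt_pos {d : ℕ} (hd : 0 < d) {m : ℕ∞}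
    (hm : (((d - 1) ^ 2 : ℕ) : ℕ∞) < m) : 0 < 1 - ((d : ℝ) - 1) * m.invSqrt := by
  cases m with
  | top => rw [ENat.invSqrt_top]; norm_num
  | coe n =>
    have hn : (d - 1) ^ 2 < n := by exact_mod_cast hm
    have hn' : ((d : ℝ) - 1) ^ 2 < n := by
      have : (((d - 1) ^ 2 : ℕ) : ℝ) < n := by exact_mod_cast hn
      rwa [Nat.cast_pow, Nat.cast_sub hd, Nat.cast_one] at this
    have hn0 : (0 : ℝ) < n := (sq_nonneg _).trans_lt hn'
    rw [ENat.invSqrt_coe, mul_one_div, sub_pos, div_lt_one (Real.sqrt_pos.2 hn0)]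
    exact Real.lt_sqrt_of_sq_lt hn'

/-- Quantifying over all natural `N ≤ m` covers `m = ⊤` as well, where it forces `‖v‖ = 0`. -/
theorem norm_le_invSqrt_mul {V : Type*} [SeminormedAddCommGroup V] {m : ℕ∞} (hm : 1 ≤ m)
    {v w : V} (h : ∀ N : ℕ, (N : ℕ∞) ≤ m → N * ‖v‖ ^ 2 ≤ ‖w‖ ^ 2) : ‖v‖ ≤ m.invSqrt * ‖w‖ := by
  cases m with
  | top =>
    rw [ENat.invSqrt_top, zero_mul]
    by_contra! hpos
    obtain ⟨N, hN⟩ := exists_nat_gt (‖w‖ ^ 2 / ‖v‖ ^ 2)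
    rw [div_lt_iff₀ (by positivity)] at hN
    exact absurd (h N le_top) (not_le.2 hN)
  | coe n =>
    have hn : 0 < n := by exact_mod_cast hm
    have hn0 : (0 : ℝ) < n := by exact_mod_cast hn
    have h1 := h n le_rfl
    rw [ENat.invSqrt_coe, one_div, ← Real.sqrt_inv]
    refine (pow_le_pow_iff_left₀ (norm_nonneg _) (by positivity) two_ne_zero).1 ?_
    rw [mul_pow, Real.sq_sqrt (by positivity), inv_mul_eq_div, le_div_iff₀ hn0]
    linarith

/-- With trivial commutators, a compatible subgroup contains every `x`, since `x` pairs like `0 ∈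
K`; no proper one exists. So non-edges do not affect `m`. -/
theorem CentralPair.of_commute {G A B : Type*} [Group G] [AddCommGroup A] [AddCommGroup B]
    {a : A → G} {b : B → G} (ha : ∀ x x', a (x + x') = a x * a x')
    (hb : ∀ x x', b (x + x') = b x * b x') (h : ∀ x y, Commute (a x) (b y)) :
    CentralPair a b ∧ ∀ N, CentralPair.IndexBound a b N := by
  have h1 : ∀ x y, ⁅a x, b y⁆ = 1 := fun x y => commutatorElement_eq_one_iff_commute.2 (h x y)
  refine ⟨⟨ha, hb, fun x y _ => ?_, fun x y _ => ?_⟩, fun N K hK htop => ?_⟩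
  · rw [h1]; exact Commute.one_left _
  · rw [h1]; exact Commute.one_left _
  · refine absurd ((AddSubgroup.eq_top_iff' K).2 fun x => ?_) htop
    exact hK 0 K.zero_mem x fun y => ⟨0, by rw [h1, h1]⟩

section KazhdanBound

variable {G : Type*} [Group G] {d : ℕ} {A : Fin d → Type*} [∀ i, AddCommGroup (A i)]

/-- The subgroup of values of an additive family of group elements. -/
def rangeSubgroup {B : Type*} [AddCommGroup B] (x : B → G) (hx : ∀ a b, x (a + b) = x a * x b) :
    Subgroup G where
  carrier := Set.range x
  mul_mem' := by
    rintro _ _ ⟨a, rfl⟩ ⟨b, rfl⟩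
    exact ⟨a + b, hx a b⟩
  one_mem' := ⟨0, map_zero_of_map_add hx⟩
  inv_mem' := by
    rintro _ ⟨a, rfl⟩
    exact ⟨-a, map_neg_of_map_add hx a⟩

/-- A lower bound for the Kazhdan constant of a group generated by subgroups with large pairwise
angles. -/
theorem ofReal_sqrt_le_kazhdanConst [∀ i, AddGroup.FG (A i)] (hd : 0 < d)
    (x : ∀ i, A i → G) (hx : ∀ i a b, x i (a + b) = x i a * x i b)
    (hgen : Subgroup.closure {g | ∃ i a, g = x i a} = ⊤) {m : ℕ∞} (hm : 1 ≤ m)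
    (hpair : ∀ i j, i < j → CentralPair (x i) (x j) ∧
      ∀ N : ℕ, (N : ℕ∞) ≤ m → CentralPair.IndexBound (x i) (x j) N) :
    ENNReal.ofReal (Real.sqrt (2 / (d : ℝ) * (1 - ((d : ℝ) - 1) * m.invSqrt))) ≤
      kazhdanConst.{v} G {g | ∃ i a, g = x i a} := by
  unfold kazhdanConst
  refine le_iInf fun V => le_iInf fun _ => le_iInf fun _ => le_iInf fun _ => le_iInf fun π =>
    le_iInf fun hπ => ?_
  unfold UnitaryRep.kazhdanConst
  refine le_iInf fun δ => le_iInf fun ⟨hδ, v, hv0, hv⟩ => ?_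
  apply ENNReal.ofReal_le_ofReal
  rw [Real.sqrt_le_iff]
  refine ⟨hδ.le, ?_⟩
  have hsum := sum_norm_sub_starProjection_sq_ge (fun i => π.fixed (Set.range (x i)))
    (ε := m.invSqrt) ?_ ?_ v
  · have hdist : ∀ i, ‖v - π.proj (Set.range (x i)) v‖ ^ 2 ≤ (δ * ‖v‖) ^ 2 / 2 := by
      intro i
      have := π.two_mul_norm_sub_proj_sq_le (rangeSubgroup (x i) (hx i)) (δ := δ * ‖v‖) (v := v)
        (by rintro _ ⟨a, rfl⟩; exact hv _ ⟨i, a, rfl⟩)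
      change 2 * ‖v - π.proj (Set.range (x i)) v‖ ^ 2 ≤ (δ * ‖v‖) ^ 2 at this
      linarith
    -- `(1 - (d - 1) / √m) ‖v‖² ≤ d δ² ‖v‖² / 2`, which is the claimed bound on `δ²` since `v ≠ 0`.
    have h1 := hsum.trans (Finset.sum_le_sum fun i _ => hdist i)
    rw [Finset.sum_const, Finset.card_univ, Fintype.card_fin, nsmul_eq_mul, mul_pow,
      ← mul_div_assoc, ← mul_assoc, mul_div_right_comm] at h1
    have h2 := le_of_mul_le_mul_right h1 (by positivity)
    have hd0 : (0 : ℝ) < d := by exact_mod_cast hd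
    rw [div_mul_eq_mul_div, div_le_iff₀ hd0]
    linarith
  · intro i j hij w
    have : CompleteSpace ↥(π.fixed (Set.range (x i)) ⊓ π.fixed (Set.range (x j))) :=
      ((π.isClosed_fixed _).inter (π.isClosed_fixed _)).isComplete.completeSpace_coe
    refine re_inner_sub_starProjection_ge _ _ (ENat.invSqrt_nonneg m) (ENat.invSqrt_le_one m hm)
      ?_ w
    intro y hy hyo
    obtain ⟨hp, hN⟩ := hpair i j hij
    exact norm_le_invSqrt_mul hm fun N hNm => hp.mul_norm_proj_sq_le (hN N hNm) π hy hyo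
  · intro w hw
    apply hπ
    intro g
    have hg : g ∈ Subgroup.closure {g | ∃ i a, g = x i a} := by rw [hgen]; trivial
    induction hg using Subgroup.closure_induction with
    | mem g hg =>
      obtain ⟨i, a, rfl⟩ := hg
      exact hw i _ ⟨a, rfl⟩
    | one => rw [map_one]; rfl
    | mul g h _ _ hg hh => rw [π.mul_apply, hh, hg]
    | inv g _ hg => exact π.inv_apply_eq hg

theorem hasPropertyT_of_finite [∀ i, AddGroup.FG (A i)] (hd : 0 < d)
    (x : ∀ i, A i → G) (hx : ∀ i a b, x i (a + b) = x i a * x i b)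
    (hgen : Subgroup.closure {g | ∃ i a, g = x i a} = ⊤) {m : ℕ∞}
    (hm : (((d - 1) ^ 2 : ℕ) : ℕ∞) < m)
    (hpair : ∀ i j, i < j → CentralPair (x i) (x j) ∧
      ∀ N : ℕ, (N : ℕ∞) ≤ m → CentralPair.IndexBound (x i) (x j) N)
    (hfin : ∀ i, Finite (A i)) : HasPropertyT.{v} G := by
  refine ⟨{g | ∃ i a, g = x i a}, ?_, ?_⟩
  · have : {g | ∃ i a, g = x i a} = Set.range fun s : Σ i, A i => x s.1 s.2 := by
      ext g
      simp only [Set.mem_ofPred_eq, Set.mem_range, Sigma.exists, eq_comm]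
    rw [this]
    exact Set.finite_range _
  · refine lt_of_lt_of_le ?_ (ofReal_sqrt_le_kazhdanConst.{v} hd x hx hgen (m := m)
      (Order.one_le_iff_pos.2 (bot_le.trans_lt hm)) hpair)
    rw [ENNReal.ofReal_pos, Real.sqrt_pos]
    have hd0 : (0 : ℝ) < d := by exact_mod_cast hd
    have := ENat.one_sub_mul_invSqrt_pos hd hm
    positivity

end KazhdanBound

/-! ### Mixed Kac–Moody–Steinberg groups. -/

theorem le_index_of_le_minRightIdealIndex {R A : Type*} [Ring R] [AddCommGroup A] [Module Rᵐᵒᵖ A]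
    {N : ℕ} (hN : (N : ℕ∞) ≤ minRightIdealIndex R) (K : AddSubgroup A)
    (hK : ∀ x ∈ K, ∀ r : R, MulOpposite.op r • x ∈ K) (htop : K ≠ ⊤) :
    N ≤ K.index ∨ K.index = 0 := by
  by_cases h0 : K.index = 0
  · exact Or.inr h0
  left
  obtain ⟨x, hx⟩ : ∃ x, x ∉ K := by
    by_contra! h
    exact htop ((AddSubgroup.eq_top_iff' K).2 h)
  -- The annihilator of the class of `x` in `A ⧸ K` is a proper right ideal, and `r ↦ x r` embeds `R
  -- ⧸ I` into `A ⧸ K`.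
  let I : Submodule Rᵐᵒᵖ R :=
    { carrier := {r | MulOpposite.op r • x ∈ K}
      add_mem' := fun {r s} hr hs => by
        have : MulOpposite.op (r + s) • x = MulOpposite.op r • x + MulOpposite.op s • x := by
          rw [MulOpposite.op_add, add_smul]
        change MulOpposite.op (r + s) • x ∈ K
        rw [this]
        exact K.add_mem hr hs
      zero_mem' := by
        change MulOpposite.op 0 • x ∈ K
        rw [MulOpposite.op_zero, zero_smul]
        exact K.zero_mem
      smul_mem' := fun c r hr => by
        change MulOpposite.op (r * c.unop) • x ∈ K
        rw [MulOpposite.op_mul, mul_smul]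
        exact hK _ hr _ }
  have hmemI : ∀ r, r ∈ I ↔ MulOpposite.op r • x ∈ K := fun r => Iff.rfl
  have hI : I ≠ ⊤ := by
    intro h
    have : (1 : R) ∈ I := by rw [h]; trivial
    rw [hmemI, MulOpposite.op_one, one_smul] at this
    exact hx this
  have h1 : (N : ℕ∞) ≤ ENat.card (R ⧸ I) := hN.trans (iInf₂_le I hI)
  have : K.FiniteIndex := ⟨h0⟩
  have hfin : Finite (A ⧸ K) := AddSubgroup.finite_quotient_of_finiteIndex
  let g : R ⧸ I → A ⧸ K := fun q =>
    QuotientAddGroup.mk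
      (MulOpposite.op (Function.surjInv (Submodule.Quotient.mk_surjective I) q) • x)
  have hg : Function.Injective g := by
    intro q q' hqq
    have h2 := QuotientAddGroup.eq_iff_sub_mem.1 hqq
    rw [← sub_smul, ← MulOpposite.op_sub, ← hmemI, ← Submodule.Quotient.eq,
      Function.surjInv_eq (Submodule.Quotient.mk_surjective I),
      Function.surjInv_eq (Submodule.Quotient.mk_surjective I)] at h2
    exact h2
  have := Finite.of_injective g hg
  have h3 := Nat.card_le_card_of_injective g hg
  rw [ENat.card_eq_coe_natCard] at h1
  exact (Nat.cast_le.1 h1).trans h3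

namespace KMSGroup

variable {d : ℕ} (X : SimpleGraph (Fin d)) (M : Fin d → Type u) [∀ i, AddCommGroup (M i)]
  (R : KMSEdge X → Type w) [∀ e, Ring (R e)]
  [∀ e : KMSEdge X, Module (R e)ᵐᵒᵖ (M e.1.1)] [∀ e : KMSEdge X, Module (R e) (M e.1.2)]

/-- The generator `x_i(a)`. -/
def gen (i : Fin d) (a : M i) : KMSGroup X M R := PresentedGroup.of ⟨i, a⟩

theorem mk_eq_one {w : FreeGroup (Σ i, M i)} (h : KMSRelator X M R w) :
    PresentedGroup.mk {w | KMSRelator X M R w} w = 1 :=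
  PresentedGroup.one_of_mem h

theorem gen_add (i : Fin d) (a b : M i) :
    gen X M R i (a + b) = gen X M R i a * gen X M R i b := by
  have := mk_eq_one X M R (.add i a b)
  rw [map_mul, map_mul, map_inv, mul_inv_eq_one] at this
  exact this.symm

theorem closure_gen : Subgroup.closure {g | ∃ i a, g = gen X M R i a} = ⊤ := by
  rw [← PresentedGroup.closure_range_of]
  congr 1
  ext g
  constructor
  · rintro ⟨i, a, rfl⟩; exact ⟨⟨i, a⟩, rfl⟩
  · rintro ⟨⟨i, a⟩, rfl⟩; exact ⟨i, a, rfl⟩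

theorem centralPair_gen {i j : Fin d} (hij : i < j) {m : ℕ∞}
    (hm : m = ⨅ e : KMSEdge X, minRightIdealIndex (R e)) :
    CentralPair (gen X M R i) (gen X M R j) ∧
      ∀ N : ℕ, (N : ℕ∞) ≤ m → CentralPair.IndexBound (gen X M R i) (gen X M R j) N := by
  by_cases hadj : X.Adj i j
  · let e : KMSEdge X := ⟨(i, j), hij, hadj⟩
    refine ⟨⟨gen_add X M R i, gen_add X M R j, fun a b c => ?_, fun a b c => ?_⟩, ?_⟩
    · rw [← commutatorElement_eq_one_iff_commute]
      have := mk_eq_one X M R (.central_left e a b c)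
      rwa [map_commutatorElement, map_commutatorElement] at this
    · rw [← commutatorElement_eq_one_iff_commute]
      have := mk_eq_one X M R (.central_right e a b c)
      rwa [map_commutatorElement, map_commutatorElement] at this
    · intro N hN K hK htop
      have hNe : (N : ℕ∞) ≤ minRightIdealIndex (R e) := hN.trans (hm ▸ iInf_le _ e)
      refine le_index_of_le_minRightIdealIndex (R := R e) (A := M e.1.1) hNe K ?_ htop
      intro x hx r
      -- The balancing relation `[x r, y] = [x, r y]` makes compatible subgroups stable under `R e`.
      refine hK x hx _ fun y => ⟨(r • (show M e.1.2 from y) : M e.1.2), ?_⟩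
      have := mk_eq_one X M R (.balanced e x y r)
      rw [map_mul, map_inv, mul_inv_eq_one, map_commutatorElement, map_commutatorElement] at this
      exact this
  · obtain ⟨h1, h2⟩ := CentralPair.of_commute (gen_add X M R i) (gen_add X M R j) fun a b => by
      rw [← commutatorElement_eq_one_iff_commute]
      have := mk_eq_one X M R (.comm i j hadj a b)
      rwa [map_commutatorElement] at this
    exact ⟨h1, fun N _ => h2 N⟩

end KMSGroup

/-! ### Chevalley generators and the automorphisms lifting simple reflections. -/

namespace KacMoody

variable {d : ℕ} {A : Matrix (Fin d) (Fin d) ℤ}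

/-- The Chevalley generator `H_i`. -/
noncomputable def H (A : Matrix (Fin d) (Fin d) ℤ) (i : Fin d) : Alg A :=
  LieSubmodule.Quotient.mk (FreeLieAlgebra.of ℂ (CartanMatrix.Generators.H i))

theorem mk_eq_zero_of_relation {z : FreeLieAlgebra ℂ (CartanMatrix.Generators (Fin d))}
    (h : z ∈ CartanMatrix.Relations.toSet ℂ A) :
    (LieSubmodule.Quotient.mk z : Alg A) = 0 :=
  (LieSubmodule.Quotient.mk_eq_zero' (N := CartanMatrix.Relations.toIdeal ℂ A)).2
    (LieSubmodule.subset_lieSpan h)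

theorem lie_E_F_self (i : Fin d) : ⁅E A i, F A i⁆ = H A i := by
  have h := mk_eq_zero_of_relation (A := A)
    (z := ⁅FreeLieAlgebra.of ℂ (CartanMatrix.Generators.E i),
      FreeLieAlgebra.of ℂ (CartanMatrix.Generators.F i)⁆ -
      FreeLieAlgebra.of ℂ (CartanMatrix.Generators.H i)) (by
    refine Or.inl (Or.inl (Or.inl (Or.inl (Or.inr ⟨(i, i), ?_⟩))))
    simp [CartanMatrix.Relations.EF])
  exact sub_eq_zero.1 h

theorem lie_E_F_of_ne {i j : Fin d} (hij : i ≠ j) : ⁅E A i, F A j⁆ = 0 := by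
  refine mk_eq_zero_of_relation (A := A)
    (z := ⁅FreeLieAlgebra.of ℂ (CartanMatrix.Generators.E i),
      FreeLieAlgebra.of ℂ (CartanMatrix.Generators.F j)⁆) ?_
  refine Or.inl (Or.inl (Or.inl (Or.inl (Or.inr ⟨(i, j), ?_⟩))))
  simp [CartanMatrix.Relations.EF, hij]

theorem lie_H_E (i j : Fin d) : ⁅H A i, E A j⁆ = A i j • E A j := by
  have h := mk_eq_zero_of_relation (A := A)
    (z := ⁅FreeLieAlgebra.of ℂ (CartanMatrix.Generators.H i),
      FreeLieAlgebra.of ℂ (CartanMatrix.Generators.E j)⁆ -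
      A i j • FreeLieAlgebra.of ℂ (CartanMatrix.Generators.E j))
    (Or.inl (Or.inl (Or.inl (Or.inr ⟨(i, j), rfl⟩))))
  exact sub_eq_zero.1 h

theorem lie_H_F (i j : Fin d) : ⁅H A i, F A j⁆ = -(A i j • F A j) := by
  have h := mk_eq_zero_of_relation (A := A)
    (z := ⁅FreeLieAlgebra.of ℂ (CartanMatrix.Generators.H i),
      FreeLieAlgebra.of ℂ (CartanMatrix.Generators.F j)⁆ +
      A i j • FreeLieAlgebra.of ℂ (CartanMatrix.Generators.F j))
    (Or.inl (Or.inl (Or.inr ⟨(i, j), rfl⟩)))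
  exact eq_neg_of_add_eq_zero_left h

theorem lie_E_E_of_eq_zero {i j : Fin d} (hA : A i j = 0) : ⁅E A i, E A j⁆ = 0 := by
  refine mk_eq_zero_of_relation (A := A)
    (z := ⁅FreeLieAlgebra.of ℂ (CartanMatrix.Generators.E i),
      FreeLieAlgebra.of ℂ (CartanMatrix.Generators.E j)⁆) ?_
  refine Or.inl (Or.inr ⟨(i, j), ?_⟩)
  simp [CartanMatrix.Relations.adE, hA]

theorem lie_F_F_of_eq_zero {i j : Fin d} (hA : A i j = 0) : ⁅F A i, F A j⁆ = 0 := by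
  refine mk_eq_zero_of_relation (A := A)
    (z := ⁅FreeLieAlgebra.of ℂ (CartanMatrix.Generators.F i),
      FreeLieAlgebra.of ℂ (CartanMatrix.Generators.F j)⁆) ?_
  refine Or.inr ⟨(i, j), ?_⟩
  simp [CartanMatrix.Relations.adF, hA]

theorem lie_E_lie_E_E {i j : Fin d} (hA : A i j = -1) : ⁅E A i, ⁅E A i, E A j⁆⁆ = 0 := by
  refine mk_eq_zero_of_relation (A := A)
    (z := ⁅FreeLieAlgebra.of ℂ (CartanMatrix.Generators.E i),
      ⁅FreeLieAlgebra.of ℂ (CartanMatrix.Generators.E i),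
      FreeLieAlgebra.of ℂ (CartanMatrix.Generators.E j)⁆⁆) ?_
  refine Or.inl (Or.inr ⟨(i, j), ?_⟩)
  simp [CartanMatrix.Relations.adE, hA]

theorem lie_F_lie_F_F {i j : Fin d} (hA : A i j = -1) : ⁅F A i, ⁅F A i, F A j⁆⁆ = 0 := by
  refine mk_eq_zero_of_relation (A := A)
    (z := ⁅FreeLieAlgebra.of ℂ (CartanMatrix.Generators.F i),
      ⁅FreeLieAlgebra.of ℂ (CartanMatrix.Generators.F i),
      FreeLieAlgebra.of ℂ (CartanMatrix.Generators.F j)⁆⁆) ?_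
  refine Or.inr ⟨(i, j), ?_⟩
  simp [CartanMatrix.Relations.adF, hA]

theorem expAd_eq_sum {x y : Alg A} {k : ℕ} (h : ((LieAlgebra.ad ℂ (Alg A) x) ^ k) y = 0) :
    expAd A x y = ∑ n ∈ Finset.range k,
      ((n.factorial : ℂ)⁻¹) • ((LieAlgebra.ad ℂ (Alg A) x) ^ n) y := by
  unfold expAd
  apply finsum_eq_sum_of_support_subset
  intro n hn
  rw [Finset.coe_range, Set.mem_Iio]
  by_contra! hkn
  apply hn
  obtain ⟨m, rfl⟩ := Nat.exists_eq_add_of_le hkn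
  change _ • _ = _
  rw [add_comm, pow_add, Module.End.mul_apply, h, map_zero, smul_zero]

theorem expAd_of_lie_eq_zero {x y : Alg A} (h : ⁅x, y⁆ = 0) : expAd A x y = y := by
  rw [expAd_eq_sum (k := 1) (by simpa using h)]
  simp

theorem expAd_of_lie_lie_eq_zero {x y : Alg A} (h : ⁅x, ⁅x, y⁆⁆ = 0) :
    expAd A x y = y + ⁅x, y⁆ := by
  rw [expAd_eq_sum (k := 2) (by simpa [pow_succ] using h)]
  simp [Finset.sum_range_succ]

theorem expAd_of_lie_lie_lie_eq_zero {x y : Alg A} (h : ⁅x, ⁅x, ⁅x, y⁆⁆⁆ = 0) :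
    expAd A x y = y + ⁅x, y⁆ + (2 : ℂ)⁻¹ • ⁅x, ⁅x, y⁆⁆ := by
  rw [expAd_eq_sum (k := 3) (by simpa [pow_succ] using h)]
  simp [Finset.sum_range_succ, pow_succ]

end KacMoody

namespace KacMoody

variable {d : ℕ} {A : Matrix (Fin d) (Fin d) ℤ}

section Rank1

variable {i : Fin d}

theorem lie_F_E_self (i : Fin d) : ⁅F A i, E A i⁆ = -H A i := by
  rw [← lie_skew, lie_E_F_self]

theorem lie_E_H_self (hA : A i i = 2) : ⁅E A i, H A i⁆ = -((2 : ℂ) • E A i) := by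
  rw [← lie_skew, lie_H_E, hA]; module

theorem lie_F_H_self (hA : A i i = 2) : ⁅F A i, H A i⁆ = (2 : ℂ) • F A i := by
  rw [← lie_skew, lie_H_F, hA]; module

theorem reflAut_E_self (hA : A i i = 2) : reflAut A i (E A i) = -F A i := by
  have h1 : expAd A (-F A i) (E A i) = E A i + H A i - F A i := by
    rw [expAd_of_lie_lie_lie_eq_zero] <;> simp [lie_F_E_self, lie_F_H_self hA]
    module
  have h2 : expAd A (E A i) (E A i + H A i - F A i) = -F A i := by
    rw [expAd_of_lie_lie_lie_eq_zero] <;> simp [lie_E_F_self, lie_E_H_self hA]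
    module
  rw [reflAut, expAd_of_lie_eq_zero (lie_self (E A i)), h1, h2]

end Rank1

theorem expAd_neg (x y : Alg A) : expAd A x (-y) = -expAd A x y := by
  simp only [expAd, map_neg, smul_neg]
  exact finsum_neg_distrib _

theorem reflAut_neg (i : Fin d) (y : Alg A) : reflAut A i (-y) = -reflAut A i y := by
  simp only [reflAut, expAd_neg]

section Rank2

variable {i j : Fin d}

theorem lie_F_E_of_ne (hij : i ≠ j) : ⁅F A i, E A j⁆ = 0 := by
  rw [← lie_skew, lie_E_F_of_ne hij.symm, neg_zero]

theorem reflAut_E_of_eq_zero (hij : i ≠ j) (hA : A i j = 0) : reflAut A i (E A j) = E A j := by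
  have h1 : ⁅E A i, E A j⁆ = 0 := lie_E_E_of_eq_zero hA
  have h2 : ⁅-F A i, E A j⁆ = 0 := by rw [neg_lie, lie_F_E_of_ne hij, neg_zero]
  rw [reflAut, expAd_of_lie_eq_zero h1, expAd_of_lie_eq_zero h2, expAd_of_lie_eq_zero h1]

theorem reflAut_F_of_eq_zero (hij : i ≠ j) (hA : A i j = 0) : reflAut A i (F A j) = F A j := by
  have h1 : ⁅E A i, F A j⁆ = 0 := lie_E_F_of_ne hij
  have h2 : ⁅-F A i, F A j⁆ = 0 := by rw [neg_lie, lie_F_F_of_eq_zero hA, neg_zero]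
  rw [reflAut, expAd_of_lie_eq_zero h1, expAd_of_lie_eq_zero h2, expAd_of_lie_eq_zero h1]

theorem lie_F_lie_E_E (hij : i ≠ j) (hA : A i j = -1) : ⁅F A i, ⁅E A i, E A j⁆⁆ = E A j := by
  rw [leibniz_lie, lie_F_E_self, lie_F_E_of_ne hij, lie_zero, add_zero, neg_lie, lie_H_E, hA]
  simp

theorem lie_E_lie_F_F (hij : i ≠ j) (hA : A i j = -1) : ⁅E A i, ⁅F A i, F A j⁆⁆ = F A j := by
  rw [leibniz_lie, lie_E_F_self, lie_E_F_of_ne hij, lie_zero, add_zero, lie_H_F, hA]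
  simp

theorem reflAut_E_of_eq_neg_one (hij : i ≠ j) (hA : A i j = -1) :
    reflAut A i (E A j) = ⁅E A i, E A j⁆ := by
  have h1 : expAd A (E A i) (E A j) = E A j + ⁅E A i, E A j⁆ :=
    expAd_of_lie_lie_eq_zero (lie_E_lie_E_E hA)
  have h2 : expAd A (-F A i) (E A j + ⁅E A i, E A j⁆) = ⁅E A i, E A j⁆ := by
    rw [expAd_of_lie_lie_eq_zero] <;> simp [-lie_skew, lie_F_lie_E_E hij hA, lie_F_E_of_ne hij]
  rw [reflAut, h1, h2, expAd_of_lie_eq_zero (lie_E_lie_E_E hA)]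

theorem reflAut_lie_E_E (hij : i ≠ j) (hA : A i j = -1) : reflAut A i ⁅E A i, E A j⁆ = -E A j := by
  have h2 : expAd A (-F A i) ⁅E A i, E A j⁆ = ⁅E A i, E A j⁆ - E A j := by
    rw [expAd_of_lie_lie_eq_zero] <;> simp [-lie_skew, lie_F_lie_E_E hij hA, lie_F_E_of_ne hij]
    abel
  have h3 : expAd A (E A i) (⁅E A i, E A j⁆ - E A j) = -E A j := by
    rw [expAd_of_lie_lie_eq_zero] <;> simp [-lie_skew, lie_E_lie_E_E hA]
    abel
  rw [reflAut, expAd_of_lie_eq_zero (lie_E_lie_E_E hA), h2, h3]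

theorem reflAut_F_of_eq_neg_one (hij : i ≠ j) (hA : A i j = -1) :
    reflAut A i (F A j) = -⁅F A i, F A j⁆ := by
  have h2 : expAd A (-F A i) (F A j) = F A j - ⁅F A i, F A j⁆ := by
    rw [expAd_of_lie_lie_eq_zero] <;> simp [-lie_skew, lie_F_lie_F_F hA]
    abel
  have h3 : expAd A (E A i) (F A j - ⁅F A i, F A j⁆) = -⁅F A i, F A j⁆ := by
    rw [expAd_of_lie_lie_eq_zero] <;> simp [-lie_skew, lie_E_lie_F_F hij hA, lie_E_F_of_ne hij]
    abel
  rw [reflAut, expAd_of_lie_eq_zero (lie_E_F_of_ne hij), h2, h3]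

theorem reflAut_lie_F_F (hij : i ≠ j) (hA : A i j = -1) : reflAut A i ⁅F A i, F A j⁆ = F A j := by
  have h1 : expAd A (E A i) ⁅F A i, F A j⁆ = ⁅F A i, F A j⁆ + F A j := by
    rw [expAd_of_lie_lie_eq_zero] <;> simp [-lie_skew, lie_E_lie_F_F hij hA, lie_E_F_of_ne hij]
  have h2 : expAd A (-F A i) (⁅F A i, F A j⁆ + F A j) = F A j := by
    rw [expAd_of_lie_lie_eq_zero] <;> simp [-lie_skew, lie_F_lie_F_F hA]
  rw [reflAut, h1, h2, expAd_of_lie_eq_zero (lie_E_F_of_ne hij)]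

/-- The two signs cancel, so the vector is exactly `E A i` and not its opposite. This exactness,
here and for `F`, gives the braid relation for the `n_i` themselves rather than only up to the
torus. -/
theorem reflAut_reflAut_E (hij : i ≠ j) (hij' : A i j = -1) (hji : A j i = -1) :
    reflAut A j (reflAut A i (E A j)) = E A i := by
  rw [reflAut_E_of_eq_neg_one hij hij', ← lie_skew, reflAut_neg, reflAut_lie_E_E hij.symm hji,
    neg_neg]

theorem reflAut_reflAut_F (hij : i ≠ j) (hij' : A i j = -1) (hji : A j i = -1) :
    reflAut A j (reflAut A i (F A j)) = F A i := by
  rw [reflAut_F_of_eq_neg_one hij hij', lie_skew]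
  exact reflAut_lie_F_F hij.symm hji

end Rank2

end KacMoody

/-! ### The root lattice, the invariant form and the Weyl group as a Coxeter group. -/

namespace KacMoody

variable {d : ℕ} {A : Matrix (Fin d) (Fin d) ℤ}

theorem cartan_symm (hA : IsGeneralizedCartan A) (hS : A.IsSimplyLaced) (i j : Fin d) :
    A i j = A j i := by
  by_cases hij : i = j
  · rw [hij]
  · have h1 := hA.zero_iff i j
    rcases hS hij with h | h <;> rcases hS (Ne.symm hij) with h' | h' <;> rw [h, h'] <;> simp_all

theorem mulVec_simpleRoot (A : Matrix (Fin d) (Fin d) ℤ) (i j : Fin d) :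
    A.mulVec (simpleRoot j) i = A i j := by
  rw [simpleRoot, Matrix.mulVec_single_one]; rfl

theorem reflection_apply (A : Matrix (Fin d) (Fin d) ℤ) (i : Fin d) (γ : Fin d → ℤ) :
    reflection A i γ = γ - A.mulVec γ i • simpleRoot i := rfl

theorem reflection_simpleRoot (A : Matrix (Fin d) (Fin d) ℤ) (i j : Fin d) :
    reflection A i (simpleRoot j) = simpleRoot j - A i j • simpleRoot i := by
  rw [reflection_apply, mulVec_simpleRoot]

theorem reflection_simpleRoot_self (hA : IsGeneralizedCartan A) (i : Fin d) :
    reflection A i (simpleRoot i) = -simpleRoot i := by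
  rw [reflection_simpleRoot, hA.diag]; module

theorem reflection_simpleRoot_of_eq_zero {i j : Fin d} (h : A i j = 0) :
    reflection A i (simpleRoot j) = simpleRoot j := by
  rw [reflection_simpleRoot, h]; module

theorem reflection_simpleRoot_of_eq_neg_one {i j : Fin d} (h : A i j = -1) :
    reflection A i (simpleRoot j) = simpleRoot i + simpleRoot j := by
  rw [reflection_simpleRoot, h]; module

theorem mulVec_reflection (A : Matrix (Fin d) (Fin d) ℤ) (i j : Fin d) (γ : Fin d → ℤ) :
    A.mulVec (reflection A i γ) j = A.mulVec γ j - A.mulVec γ i * A j i := by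
  rw [reflection_apply, Matrix.mulVec_sub, Matrix.mulVec_smul, Pi.sub_apply, Pi.smul_apply,
    mulVec_simpleRoot, smul_eq_mul]

theorem reflection_mul_self (hA : IsGeneralizedCartan A) (i : Fin d) :
    reflection A i * reflection A i = 1 := by
  refine LinearMap.ext fun γ => ?_
  rw [Module.End.mul_apply, Module.End.one_apply, reflection_apply A i (reflection A i γ),
    mulVec_reflection, reflection_apply, hA.diag]
  module

theorem reflection_commute (hA : IsGeneralizedCartan A) {i j : Fin d} (h : A i j = 0) :
    reflection A i * reflection A j = reflection A j * reflection A i := by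
  have h' := (hA.zero_iff i j).1 h
  refine LinearMap.ext fun γ => ?_
  rw [Module.End.mul_apply, Module.End.mul_apply, reflection_apply A i (reflection A j γ),
    reflection_apply A j (reflection A i γ),
    mulVec_reflection, mulVec_reflection, h, h', reflection_apply, reflection_apply]
  module

theorem reflection_reflection_reflection (hA : IsGeneralizedCartan A) {i j : Fin d}
    (h : A i j = -1) (h' : A j i = -1) (γ : Fin d → ℤ) :
    reflection A i (reflection A j (reflection A i γ)) =
      γ - (A.mulVec γ i + A.mulVec γ j) • (simpleRoot i + simpleRoot j) := by
  rw [reflection_apply A i (reflection A j (reflection A i γ))]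
  simp only [mulVec_reflection, h, h', hA.diag]
  rw [reflection_apply A j (reflection A i γ)]
  simp only [mulVec_reflection, h']
  rw [reflection_apply]
  module

theorem reflection_braid (hA : IsGeneralizedCartan A) {i j : Fin d} (h : A i j = -1)
    (h' : A j i = -1) : reflection A i * reflection A j * reflection A i =
      reflection A j * reflection A i * reflection A j := by
  refine LinearMap.ext fun γ => ?_
  simp only [Module.End.mul_apply]
  rw [reflection_reflection_reflection hA h h', reflection_reflection_reflection hA h' h,
    add_comm (A.mulVec γ i), add_comm (simpleRoot i)]

theorem reflection_mem_weyl (A : Matrix (Fin d) (Fin d) ℤ) (i : Fin d) :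
    reflection A i ∈ weyl A := Submonoid.subset_closure ⟨i, rfl⟩

/-- The invariant quadratic form. -/
def form (A : Matrix (Fin d) (Fin d) ℤ) (γ : Fin d → ℤ) : ℤ := γ ⬝ᵥ A.mulVec γ

theorem dotProduct_mulVec_simpleRoot (hA : IsGeneralizedCartan A) (hS : A.IsSimplyLaced)
    (γ : Fin d → ℤ) (i : Fin d) : γ ⬝ᵥ A.mulVec (simpleRoot i) = A.mulVec γ i := by
  rw [Matrix.mulVec, dotProduct_comm, dotProduct, dotProduct]
  refine Finset.sum_congr rfl fun j _ => ?_
  rw [mulVec_simpleRoot, cartan_symm hA hS]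

theorem form_reflection (hA : IsGeneralizedCartan A) (hS : A.IsSimplyLaced) (i : Fin d)
    (γ : Fin d → ℤ) : form A (reflection A i γ) = form A γ := by
  rw [form, form, reflection_apply, Matrix.mulVec_sub, Matrix.mulVec_smul, sub_dotProduct,
    dotProduct_sub, dotProduct_sub, dotProduct_smul, smul_dotProduct, smul_dotProduct,
    dotProduct_smul, dotProduct_mulVec_simpleRoot hA hS, single_one_dotProduct,
    dotProduct_mulVec_simpleRoot hA hS, mulVec_simpleRoot, hA.diag]
  simp only [smul_eq_mul]
  ring

theorem form_add_simpleRoot (hA : IsGeneralizedCartan A) (hS : A.IsSimplyLaced) (i : Fin d)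
    (γ : Fin d → ℤ) : form A (γ + simpleRoot i) = form A γ + 2 * A.mulVec γ i + 2 := by
  rw [form, form, Matrix.mulVec_add, add_dotProduct, dotProduct_add, dotProduct_add,
    single_one_dotProduct, dotProduct_mulVec_simpleRoot hA hS, single_one_dotProduct,
    mulVec_simpleRoot, hA.diag]
  ring

theorem form_simpleRoot (hA : IsGeneralizedCartan A) (i : Fin d) : form A (simpleRoot i) = 2 := by
  rw [form, single_one_dotProduct, mulVec_simpleRoot, hA.diag]

/-- The form is invariant under the Weyl group. Its value detects sums that are not real roots: it
is 4 on the sum of two orthogonal simple roots and 6 on `2 α_i + α_j` for adjacent ones. -/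
theorem form_eq_two_of_isRealRoot (hA : IsGeneralizedCartan A) (hS : A.IsSimplyLaced)
    {γ : Fin d → ℤ} (h : IsRealRoot A γ) : form A γ = 2 := by
  obtain ⟨w, hw, i, rfl⟩ := h
  rw [← form_simpleRoot hA i]
  generalize simpleRoot i = β
  induction hw using Submonoid.closure_induction generalizing β with
  | mem _ hx =>
    obtain ⟨j, rfl⟩ := hx
    exact form_reflection hA hS j β
  | one => rfl
  | mul x y _ _ hx hy => rw [Module.End.mul_apply, hx, hy]

theorem not_isRealRoot_add_of_eq_zero (hA : IsGeneralizedCartan A) (hS : A.IsSimplyLaced)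
    {i j : Fin d} (h : A i j = 0) : ¬ IsRealRoot A (simpleRoot i + simpleRoot j) := by
  intro hr
  have := form_eq_two_of_isRealRoot hA hS hr
  rw [form_add_simpleRoot hA hS, form_simpleRoot hA, mulVec_simpleRoot,
    (hA.zero_iff i j).1 h] at this
  norm_num at this

theorem not_isRealRoot_add_add (hA : IsGeneralizedCartan A) (hS : A.IsSimplyLaced)
    {i j k : Fin d} (h : A i j = -1) (hk : k = i ∨ k = j) :
    ¬ IsRealRoot A (simpleRoot i + simpleRoot j + simpleRoot k) := by
  intro hr
  have := form_eq_two_of_isRealRoot hA hS hr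
  have h' : A j i = -1 := by rw [← cartan_symm hA hS, h]
  rw [form_add_simpleRoot hA hS, form_add_simpleRoot hA hS, form_simpleRoot hA, mulVec_simpleRoot,
    Matrix.mulVec_add, Pi.add_apply, mulVec_simpleRoot, mulVec_simpleRoot, h'] at this
  rcases hk with rfl | rfl
  · rw [hA.diag, h] at this; norm_num at this
  · rw [hA.diag, h'] at this; norm_num at this

theorem simpleRoot_nonneg (i : Fin d) : (0 : Fin d → ℤ) ≤ simpleRoot i :=
  Pi.single_nonneg.2 zero_le_one

theorem isPrenilpotent_of_eq_zero (hA : IsGeneralizedCartan A) {i j : Fin d}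
    (h : A i j = 0) : IsPrenilpotent A (simpleRoot i) (simpleRoot j) := by
  refine ⟨⟨1, one_mem _, simpleRoot_nonneg i, simpleRoot_nonneg j⟩,
    reflection A i * reflection A j,
    mul_mem (reflection_mem_weyl A i) (reflection_mem_weyl A j), ?_, ?_⟩
  · rw [Module.End.mul_apply, reflection_simpleRoot_of_eq_zero ((hA.zero_iff i j).1 h),
      reflection_simpleRoot_self hA]
    exact neg_nonpos.2 (simpleRoot_nonneg i)
  · rw [Module.End.mul_apply, reflection_simpleRoot_self hA, map_neg,
      reflection_simpleRoot_of_eq_zero h]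
    exact neg_nonpos.2 (simpleRoot_nonneg j)

theorem isPrenilpotent_of_mem_span (hA : IsGeneralizedCartan A) (hS : A.IsSimplyLaced)
    {i j : Fin d} (h : A i j = -1) {p q r s : ℕ} :
    IsPrenilpotent A (p • simpleRoot i + q • simpleRoot j)
      (r • simpleRoot i + s • simpleRoot j) := by
  have h' : A j i = -1 := by rw [← cartan_symm hA hS, h]
  have hnn : ∀ p q : ℕ, (0 : Fin d → ℤ) ≤ p • simpleRoot i + q • simpleRoot j := fun p q =>
    add_nonneg (nsmul_nonneg (simpleRoot_nonneg i) p) (nsmul_nonneg (simpleRoot_nonneg j) q)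
  -- The longest element of the rank two Weyl group makes all these combinations negative at once.
  have hw : ∀ p q : ℕ, (reflection A i * reflection A j * reflection A i)
      (p • simpleRoot i + q • simpleRoot j) = -(q • simpleRoot i + p • simpleRoot j) := by
    intro p q
    simp only [Module.End.mul_apply, map_add, map_nsmul, reflection_simpleRoot_self hA,
      reflection_simpleRoot_of_eq_neg_one h, reflection_simpleRoot_of_eq_neg_one h', map_neg]
    module
  have hmem : reflection A i * reflection A j * reflection A i ∈ weyl A :=
    mul_mem (mul_mem (reflection_mem_weyl A i) (reflection_mem_weyl A j)) (reflection_mem_weyl A i)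
  refine ⟨⟨1, one_mem _, hnn p q, hnn r s⟩, _, hmem, ?_, ?_⟩
  · rw [hw]; exact neg_nonpos.2 (hnn q p)
  · rw [hw]; exact neg_nonpos.2 (hnn s r)

/-- The Coxeter matrix of a simply-laced generalized Cartan matrix. -/
def coxeterMatrix (hA : IsGeneralizedCartan A) : CoxeterMatrix (Fin d) where
  M := fun i j => if i = j then 1 else if A i j = 0 then 2 else 3
  isSymm := by
    ext i j
    change (if j = i then 1 else if A j i = 0 then 2 else 3) =
      (if i = j then 1 else if A i j = 0 then 2 else 3)
    by_cases hij : i = j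
    · rw [hij]
    · simp only [hij, Ne.symm hij, if_false, hA.zero_iff i j]
  diagonal i := by simp
  off_diagonal i j hij := by
    simp only [hij, if_false]
    split_ifs <;> norm_num

theorem isLiftable_of_relations (hA : IsGeneralizedCartan A) {Q : Type*} [Monoid Q] (f : Fin d → Q)
    (h1 : ∀ i, f i * f i = 1) (h2 : ∀ i j, i ≠ j → A i j = 0 → f i * f j = f j * f i)
    (h3 : ∀ i j, i ≠ j → A i j ≠ 0 → f i * f j * f i = f j * f i * f j) :
    (coxeterMatrix hA).IsLiftable f := by
  intro i j
  change (f i * f j) ^ (if i = j then 1 else if A i j = 0 then 2 else 3) = 1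
  split_ifs with hij h0
  · rw [hij, h1, pow_one]
  · rw [sq]
    calc f i * f j * (f i * f j) = f i * f j * (f j * f i) := by rw [h2 i j hij h0]
      _ = f i * (f j * f j) * f i := by simp only [mul_assoc]
      _ = 1 := by rw [h1, mul_one, h1]
  · calc (f i * f j) ^ 3 = f i * f j * f i * (f j * f i * f j) := by
          simp only [pow_succ, pow_zero, one_mul, mul_assoc]
      _ = f i * f j * f i * (f i * f j * f i) := by rw [h3 i j hij h0]
      _ = f i * (f j * (f i * f i) * f j) * f i := by simp only [mul_assoc]
      _ = 1 := by rw [h1, mul_one, h1, mul_one, h1]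

/-- The Weyl group as a Coxeter group. -/
abbrev WeylGroup (hA : IsGeneralizedCartan A) : Type := (coxeterMatrix hA).Group

/-- The Coxeter system of the Weyl group. -/
abbrev weylSystem (hA : IsGeneralizedCartan A) :
    CoxeterSystem (coxeterMatrix hA) (WeylGroup hA) := (coxeterMatrix hA).toCoxeterSystem

/-- The action of the Weyl group on the root lattice. -/
def rootAction (hA : IsGeneralizedCartan A) (hS : A.IsSimplyLaced) :
    WeylGroup hA →* Module.End ℤ (Fin d → ℤ) :=
  (weylSystem hA).lift ⟨reflection A, isLiftable_of_relations hA _ (reflection_mul_self hA)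
    (fun _ _ _ h => reflection_commute hA h) fun _ _ hij h =>
      reflection_braid hA ((hS hij).resolve_left h)
        ((hS hij.symm).resolve_left (mt (hA.zero_iff _ _).2 h))⟩

theorem rootAction_simple (hA : IsGeneralizedCartan A) (hS : A.IsSimplyLaced) (i : Fin d) :
    rootAction hA hS ((weylSystem hA).simple i) = reflection A i :=
  (weylSystem hA).lift_apply_simple _ i

theorem simple_commute (hA : IsGeneralizedCartan A) {i j : Fin d} (hij : i ≠ j) (h : A i j = 0) :
    (weylSystem hA).simple i * (weylSystem hA).simple j =
      (weylSystem hA).simple j * (weylSystem hA).simple i := by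
  have h1 := (weylSystem hA).simple_mul_simple_pow i j
  have h2 : (coxeterMatrix hA) i j = 2 := by
    change (if i = j then 1 else if A i j = 0 then 2 else 3) = 2
    simp [hij, h]
  rw [h2, sq, ← eq_inv_iff_mul_eq_one, mul_inv_rev, CoxeterSystem.inv_simple,
    CoxeterSystem.inv_simple] at h1
  exact h1

theorem simple_braid (hA : IsGeneralizedCartan A) {i j : Fin d} (hij : i ≠ j) (h : A i j ≠ 0) :
    (weylSystem hA).simple j * (weylSystem hA).simple i * (weylSystem hA).simple j =
      (weylSystem hA).simple i * (weylSystem hA).simple j * (weylSystem hA).simple i := by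
  have h1 := (weylSystem hA).simple_mul_simple_pow i j
  have h2 : (coxeterMatrix hA) i j = 3 := by
    change (if i = j then 1 else if A i j = 0 then 2 else 3) = 3
    simp [hij, h]
  rw [h2] at h1
  have h3 : ((weylSystem hA).simple i * (weylSystem hA).simple j * (weylSystem hA).simple i) *
      ((weylSystem hA).simple j * (weylSystem hA).simple i * (weylSystem hA).simple j) = 1 := by
    rw [← h1]; simp only [pow_succ, pow_zero, one_mul, mul_assoc]
  rw [mul_eq_one_iff_eq_inv] at h3
  rw [h3]
  simp only [mul_inv_rev, CoxeterSystem.inv_simple, mul_assoc]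

end KacMoody

/-! ### The torus and the lifts of simple reflections in the Kac–Moody group. -/

namespace KacMoody

variable {d : ℕ} {A : Matrix (Fin d) (Fin d) ℤ} {K : Type*} [Field K]

theorem RootVector.ext_of_eq {e f : RootVector A} (h1 : e.root = f.root) (h2 : e.vec = f.vec) :
    e = f := by
  cases e; cases f; cases h1; cases h2; rfl

theorem mk_eq_one {w : FreeGroup (Gen A K)} (h : Relator A K w) :
    PresentedGroup.mk {w | Relator A K w} w = 1 :=
  PresentedGroup.one_of_mem h

theorem rootElt_add (e : RootVector A) (a b : K) :
    rootElt e (a + b) = rootElt e a * rootElt e b := by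
  have := mk_eq_one (Relator.add e a b)
  rw [map_mul, map_mul, map_inv, mul_inv_eq_one] at this
  exact this.symm

theorem rootElt_neg (e : RootVector A) (a : K) : rootElt e (-a) = (rootElt e a)⁻¹ :=
  map_neg_of_map_add (rootElt_add e) a

theorem rootElt_opp (e : RootVector A) (a : K) : rootElt e.opp a = rootElt e (-a) := by
  have := mk_eq_one (Relator.opp e a)
  rw [map_mul, map_inv, mul_inv_eq_one] at this
  exact this

theorem commutator_rootElt (e f : RootVector A) (a b : K) (hp : IsPrenilpotent A e.root f.root)
    (hs : IsRealRootVector A (e.root + f.root) ⁅e.vec, f.vec⁆) :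
    ⁅rootElt e a, rootElt f b⁆ = rootElt ⟨e.root + f.root, ⁅e.vec, f.vec⁆, hs⟩ (a * b) := by
  have := mk_eq_one (Relator.bracket e f a b hp hs)
  rw [map_mul, map_inv, mul_inv_eq_one, map_commutatorElement] at this
  exact this

theorem commute_rootElt (e f : RootVector A) (a b : K) (hp : IsPrenilpotent A e.root f.root)
    (hs : ¬ IsRealRoot A (e.root + f.root)) : Commute (rootElt e a) (rootElt f b) := by
  have := mk_eq_one (Relator.comm e f a b hp hs)
  rw [map_commutatorElement] at this
  exact commutatorElement_eq_one_iff_commute.1 this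

/-- The torus element `h_i(t)` of the Kac-Moody group. -/
def torusElt (i : Fin d) (t : Kˣ) : KMGroup A K := PresentedGroup.of (Gen.h i t)

/-- The element `n_i(1)` of the Kac-Moody group. -/
noncomputable def weylElt (A : Matrix (Fin d) (Fin d) ℤ) (K : Type*) [Field K] (i : Fin d) :
    KMGroup A K := PresentedGroup.mk _ (n A i (1 : Kˣ))

theorem mk_n (i : Fin d) (t : Kˣ) : PresentedGroup.mk {w | Relator A K w} (n A i t) =
    rootElt (RootVector.simple A i) (t : K) *
      rootElt (RootVector.negSimple A i) (-((t⁻¹ : Kˣ) : K)) *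
      rootElt (RootVector.simple A i) (t : K) := rfl

theorem weylElt_eq (i : Fin d) : weylElt A K i = rootElt (RootVector.simple A i) 1 *
    rootElt (RootVector.negSimple A i) (-1) * rootElt (RootVector.simple A i) 1 := by
  rw [weylElt, mk_n, inv_one, Units.val_one]

/-- The torus of the Kac-Moody group. -/
def torus (A : Matrix (Fin d) (Fin d) ℤ) (K : Type*) [Field K] : Subgroup (KMGroup A K) :=
  Subgroup.closure {g | ∃ i t, g = torusElt i t}

theorem torusElt_mem (i : Fin d) (t : Kˣ) : (torusElt i t : KMGroup A K) ∈ torus A K :=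
  Subgroup.subset_closure ⟨i, t, rfl⟩

theorem torusElt_mul (i : Fin d) (s t : Kˣ) :
    (torusElt i (s * t) : KMGroup A K) = torusElt i s * torusElt i t := by
  have := mk_eq_one (Relator.torus_mul (A := A) i s t)
  rw [map_mul, map_mul, map_inv, mul_inv_eq_one] at this
  exact this.symm

theorem torusElt_inv (i : Fin d) (t : Kˣ) :
    (torusElt i t⁻¹ : KMGroup A K) = (torusElt i t)⁻¹ := by
  have h1 : (torusElt i 1 : KMGroup A K) = 1 := by
    have := torusElt_mul (A := A) i (1 : Kˣ) 1
    rwa [mul_one, left_eq_mul] at this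
  rw [eq_inv_iff_mul_eq_one, ← torusElt_mul, inv_mul_cancel, h1]

theorem torusElt_conj_simple (i j : Fin d) (t : Kˣ) (a : K) :
    torusElt i t * rootElt (RootVector.simple A j) a * (torusElt i t)⁻¹ =
      rootElt (RootVector.simple A j) (((t ^ (A i j) : Kˣ) : K) * a) := by
  have := mk_eq_one (Relator.torus_root (A := A) i j t a)
  rw [map_mul, map_mul, map_mul, map_inv, map_inv, mul_inv_eq_one] at this
  exact this

theorem weylElt_conj_torusElt (i j : Fin d) (t : Kˣ) :
    weylElt A K i * torusElt j t * (weylElt A K i)⁻¹ =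
      torusElt j t * torusElt i (t ^ (-(A j i))) := by
  have := mk_eq_one (Relator.weyl_torus (A := A) i j t)
  rw [map_mul, map_mul, map_mul, map_inv, map_inv, map_mul, mul_inv_eq_one] at this
  exact this

theorem weylElt_conj_rootElt (i : Fin d) (e : RootVector A) (a : K) :
    weylElt A K i * rootElt e a * (weylElt A K i)⁻¹ = rootElt (e.refl i) a := by
  have := mk_eq_one (Relator.weyl_root (A := A) i e a)
  rw [map_mul, map_mul, map_mul, map_inv, map_inv, mul_inv_eq_one] at this
  exact this

/-- The relation `torus_eq` at `t = -1` compares `n_i(-1)`, which is the inverse of `n_i(1)`, with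
`n_i(1) h_i(-1)`. -/
theorem weylElt_mul_self_mem (i : Fin d) : weylElt A K i * weylElt A K i ∈ torus A K := by
  have h := mk_eq_one (Relator.torus_eq (A := A) i (-1 : Kˣ))
  rw [map_mul, map_inv, map_mul, mul_inv_eq_one, inv_neg_one, mk_n] at h
  have h1 : rootElt (RootVector.simple A i) ((-1 : Kˣ) : K) *
      rootElt (RootVector.negSimple A i) (-(((-1)⁻¹ : Kˣ) : K)) *
      rootElt (RootVector.simple A i) ((-1 : Kˣ) : K) = (weylElt A K i)⁻¹ := by
    rw [weylElt_eq, mul_inv_rev, mul_inv_rev, ← rootElt_neg, ← rootElt_neg, inv_neg_one,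
      Units.val_neg, Units.val_one, mul_assoc]
  rw [h1] at h
  have h2 : (weylElt A K i)⁻¹ = weylElt A K i * torusElt i (-1) := h
  have h3 : weylElt A K i * weylElt A K i = (torusElt i (-1))⁻¹ := by
    rw [eq_inv_iff_mul_eq_one, mul_assoc, ← h2, mul_inv_cancel]
  rw [h3]
  exact inv_mem (torusElt_mem _ _)

theorem weylElt_conj_mem_torus (i : Fin d) {t : KMGroup A K} (ht : t ∈ torus A K) :
    weylElt A K i * t * (weylElt A K i)⁻¹ ∈ torus A K := by
  have h : torus A K ≤ (torus A K).comap (MulAut.conj (weylElt A K i)).toMonoidHom := by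
    rw [torus, Subgroup.closure_le]
    rintro _ ⟨j, t, rfl⟩
    change weylElt A K i * torusElt j t * (weylElt A K i)⁻¹ ∈ torus A K
    rw [weylElt_conj_torusElt]
    exact mul_mem (torusElt_mem _ _) (torusElt_mem _ _)
  exact h ht

theorem weylElt_mem_normalizer (i : Fin d) :
    weylElt A K i ∈ Subgroup.normalizer (torus A K : Set (KMGroup A K)) := by
  rw [Subgroup.mem_normalizer_iff]
  refine fun t => ⟨weylElt_conj_mem_torus i, fun ht => ?_⟩
  have hs := weylElt_mul_self_mem (A := A) (K := K) i
  have h1 := mul_mem (mul_mem (inv_mem hs) (weylElt_conj_mem_torus i ht)) hs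
  convert h1 using 1
  group

theorem exists_conj_simple_of_mem_torus {t : KMGroup A K} (ht : t ∈ torus A K) (j : Fin d)
    (a : K) : ∃ b : K, t * rootElt (RootVector.simple A j) a * t⁻¹ =
      rootElt (RootVector.simple A j) b := by
  induction ht using Subgroup.closure_induction'' generalizing a with
  | mem _ hx =>
    obtain ⟨i, t, rfl⟩ := hx
    exact ⟨_, torusElt_conj_simple i j t a⟩
  | inv_mem _ hx =>
    obtain ⟨i, t, rfl⟩ := hx
    rw [← torusElt_inv]
    exact ⟨_, torusElt_conj_simple i j t⁻¹ a⟩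
  | one => exact ⟨a, by group⟩
  | mul x y _ _ hx hy =>
    obtain ⟨b, hb⟩ := hy a
    obtain ⟨c, hc⟩ := hx b
    exact ⟨c, by rw [← hc, ← hb]; group⟩

theorem refl_simple_self (hA : IsGeneralizedCartan A) (i : Fin d) :
    (RootVector.simple A i).refl i = (RootVector.negSimple A i).opp :=
  RootVector.ext_of_eq (reflection_simpleRoot_self hA i) (reflAut_E_self (hA.diag i))

theorem refl_simple_of_eq_zero {i j : Fin d} (hij : i ≠ j) (h : A i j = 0) :
    (RootVector.simple A j).refl i = RootVector.simple A j :=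
  RootVector.ext_of_eq (reflection_simpleRoot_of_eq_zero h) (reflAut_E_of_eq_zero hij h)

theorem refl_negSimple_of_eq_zero {i j : Fin d} (hij : i ≠ j) (h : A i j = 0) :
    (RootVector.negSimple A j).refl i = RootVector.negSimple A j := by
  refine RootVector.ext_of_eq ?_ (reflAut_F_of_eq_zero hij h)
  change reflection A i (-simpleRoot j) = -simpleRoot j
  rw [map_neg, reflection_simpleRoot_of_eq_zero h]

theorem reflection_reflection_simpleRoot (hA : IsGeneralizedCartan A) {i j : Fin d}
    (h : A i j = -1) (h' : A j i = -1) :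
    reflection A j (reflection A i (simpleRoot j)) = simpleRoot i := by
  rw [reflection_simpleRoot_of_eq_neg_one h, map_add, reflection_simpleRoot_self hA,
    reflection_simpleRoot_of_eq_neg_one h']
  abel

theorem refl_refl_simple (hA : IsGeneralizedCartan A) {i j : Fin d} (hij : i ≠ j)
    (h : A i j = -1) (h' : A j i = -1) :
    ((RootVector.simple A j).refl i).refl j = RootVector.simple A i :=
  RootVector.ext_of_eq (reflection_reflection_simpleRoot hA h h') (reflAut_reflAut_E hij h h')

theorem refl_refl_negSimple (hA : IsGeneralizedCartan A) {i j : Fin d} (hij : i ≠ j)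
    (h : A i j = -1) (h' : A j i = -1) :
    ((RootVector.negSimple A j).refl i).refl j = RootVector.negSimple A i := by
  refine RootVector.ext_of_eq ?_ (reflAut_reflAut_F hij h h')
  change reflection A j (reflection A i (-simpleRoot j)) = -simpleRoot i
  rw [map_neg, map_neg, reflection_reflection_simpleRoot hA h h']

theorem conj_weylElt_of_conj {g : KMGroup A K} {i j : Fin d}
    (h1 : ∀ a : K, g * rootElt (RootVector.simple A j) a * g⁻¹ = rootElt (RootVector.simple A i) a)
    (h2 : ∀ a : K, g * rootElt (RootVector.negSimple A j) a * g⁻¹ =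
      rootElt (RootVector.negSimple A i) a) :
    g * weylElt A K j * g⁻¹ = weylElt A K i := by
  rw [weylElt_eq, weylElt_eq, ← h1, ← h2]
  group

theorem weylElt_commute {i j : Fin d} (hij : i ≠ j) (h : A i j = 0) :
    weylElt A K i * weylElt A K j = weylElt A K j * weylElt A K i := by
  rw [← mul_inv_eq_iff_eq_mul]
  refine conj_weylElt_of_conj (fun a => ?_) fun a => ?_
  · rw [weylElt_conj_rootElt, refl_simple_of_eq_zero hij h]
  · rw [weylElt_conj_rootElt, refl_negSimple_of_eq_zero hij h]

theorem weylElt_mul_conj_rootElt (i j : Fin d) (e : RootVector A) (a : K) :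
    weylElt A K j * weylElt A K i * rootElt e a * (weylElt A K j * weylElt A K i)⁻¹ =
      rootElt ((e.refl i).refl j) a := by
  rw [← weylElt_conj_rootElt, ← weylElt_conj_rootElt]
  group

/-- Conjugation by `n_j n_i` carries the root elements for `±α_j` to those for `±α_i` with the same
parameters, hence `n_j` to `n_i`. -/
theorem weylElt_braid (hA : IsGeneralizedCartan A) {i j : Fin d} (hij : i ≠ j)
    (h : A i j = -1) (h' : A j i = -1) :
    weylElt A K i * weylElt A K j * weylElt A K i =
      weylElt A K j * weylElt A K i * weylElt A K j := by
  rw [mul_assoc, eq_comm, ← mul_inv_eq_iff_eq_mul]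
  refine conj_weylElt_of_conj (fun a => ?_) fun a => ?_
  · rw [weylElt_mul_conj_rootElt, refl_refl_simple hA hij h h']
  · rw [weylElt_mul_conj_rootElt, refl_refl_negSimple hA hij h h']

end KacMoody

/-! ### Simple root subgroups generate the positive unipotent subgroup. -/

namespace KacMoody

variable {d : ℕ} {A : Matrix (Fin d) (Fin d) ℤ}

/-- The normalizer of the torus. -/
abbrev torusNormalizer (A : Matrix (Fin d) (Fin d) ℤ) (K : Type*) [Field K] :
    Subgroup (KMGroup A K) :=
  Subgroup.normalizer (torus A K : Set (KMGroup A K))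

/-- The quotient of the normalizer of the torus by the torus. -/
abbrev torusQuotient (A : Matrix (Fin d) (Fin d) ℤ) (K : Type*) [Field K] : Type _ :=
  torusNormalizer A K ⧸ (torus A K).subgroupOf (torusNormalizer A K)

variable (K : Type*) [Field K]

/-- The image of `n_i(1)` in the quotient of the normalizer of the torus by the torus. -/
noncomputable def weylClass (A : Matrix (Fin d) (Fin d) ℤ) (K : Type*) [Field K] (i : Fin d) :
    torusQuotient A K :=
  QuotientGroup.mk ⟨weylElt A K i, weylElt_mem_normalizer i⟩

/-- The homomorphism of the Weyl group to the quotient of the normalizer of the torus. -/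
noncomputable def weylHom (hA : IsGeneralizedCartan A) (hS : A.IsSimplyLaced) :
    WeylGroup hA →* torusQuotient A K :=
  (weylSystem hA).lift ⟨weylClass A K, isLiftable_of_relations hA _
    (fun i => (QuotientGroup.eq_one_iff _).2 (Subgroup.mem_subgroupOf.2 (weylElt_mul_self_mem i)))
    (fun _ _ hij h => congrArg QuotientGroup.mk (Subtype.ext (weylElt_commute hij h)))
    fun _ _ hij h => congrArg QuotientGroup.mk (Subtype.ext (weylElt_braid hA hij
      ((hS hij).resolve_left h) ((hS hij.symm).resolve_left (mt (hA.zero_iff _ _).2 h))))⟩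

theorem weylHom_simple (hA : IsGeneralizedCartan A) (hS : A.IsSimplyLaced) (i : Fin d) :
    weylHom K hA hS ((weylSystem hA).simple i) = weylClass A K i :=
  (weylSystem hA).lift_apply_simple _ i

/-- The element `g` of the normalizer of the torus represents `w`. -/
def Represents (hA : IsGeneralizedCartan A) (hS : A.IsSimplyLaced) (w : WeylGroup hA)
    (g : KMGroup A K) : Prop :=
  ∃ hg : g ∈ torusNormalizer A K, (QuotientGroup.mk ⟨g, hg⟩ : torusQuotient A K) =
    weylHom K hA hS w

variable {K} (hA : IsGeneralizedCartan A) (hS : A.IsSimplyLaced)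

theorem represents_one : Represents K hA hS 1 1 :=
  ⟨one_mem _, (map_one (weylHom K hA hS)).symm⟩

theorem represents_simple (i : Fin d) :
    Represents K hA hS ((weylSystem hA).simple i) (weylElt A K i) :=
  ⟨weylElt_mem_normalizer i, (weylHom_simple K hA hS i).symm⟩

variable {hA hS}

theorem Represents.mul {w w' : WeylGroup hA} {g g' : KMGroup A K}
    (h : Represents K hA hS w g) (h' : Represents K hA hS w' g') :
    Represents K hA hS (w * w') (g * g') := by
  obtain ⟨hg, h⟩ := h
  obtain ⟨hg', h'⟩ := h'
  exact ⟨mul_mem hg hg', by rw [map_mul, ← h, ← h']; rfl⟩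

theorem Represents.inv {w : WeylGroup hA} {g : KMGroup A K}
    (h : Represents K hA hS w g) : Represents K hA hS w⁻¹ g⁻¹ := by
  obtain ⟨hg, h⟩ := h
  exact ⟨inv_mem hg, by rw [map_inv, ← h]; rfl⟩

theorem Represents.mem_torus {g : KMGroup A K} (h : Represents K hA hS 1 g) : g ∈ torus A K := by
  obtain ⟨hg, h⟩ := h
  rw [map_one, QuotientGroup.eq_one_iff] at h
  exact h

/-- The subgroup generated by the simple root subgroups. -/
def simpleSubgroup (A : Matrix (Fin d) (Fin d) ℤ) (K : Type*) [Field K] :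
    Subgroup (KMGroup A K) :=
  Subgroup.closure {g | ∃ i a, g = rootElt (RootVector.simple A i) a}

theorem rootElt_simple_mem (i : Fin d) (a : K) :
    rootElt (RootVector.simple A i) a ∈ simpleSubgroup A K :=
  Subgroup.subset_closure ⟨i, a, rfl⟩

theorem refl_simple_isReal {i j : Fin d} (hij : i ≠ j) (h : A i j = -1) :
    IsRealRootVector A (simpleRoot i + simpleRoot j) ⁅E A i, E A j⁆ := by
  rw [← reflection_simpleRoot_of_eq_neg_one h, ← reflAut_E_of_eq_neg_one hij h]
  exact .refl i (.pos j)

theorem refl_simple_of_eq_neg_one {i j : Fin d} (hij : i ≠ j) (h : A i j = -1) :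
    (RootVector.simple A j).refl i =
      ⟨simpleRoot i + simpleRoot j, ⁅E A i, E A j⁆, refl_simple_isReal hij h⟩ :=
  RootVector.ext_of_eq (reflection_simpleRoot_of_eq_neg_one h) (reflAut_E_of_eq_neg_one hij h)

theorem isPrenilpotent_simpleRoot (hA : IsGeneralizedCartan A) (hS : A.IsSimplyLaced)
    {i j : Fin d} (h : A i j = -1) : IsPrenilpotent A (simpleRoot i) (simpleRoot j) := by
  simpa using isPrenilpotent_of_mem_span hA hS h (p := 1) (q := 0) (r := 0) (s := 1)

theorem commutator_rootElt_simple (hA : IsGeneralizedCartan A) (hS : A.IsSimplyLaced)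
    {i j : Fin d} (hij : i ≠ j) (h : A i j = -1) (a b : K) :
    ⁅rootElt (RootVector.simple A i) a, rootElt (RootVector.simple A j) b⁆ =
      rootElt ((RootVector.simple A j).refl i) (a * b) := by
  rw [refl_simple_of_eq_neg_one hij h]
  exact commutator_rootElt _ _ a b (isPrenilpotent_simpleRoot hA hS h) (refl_simple_isReal hij h)

variable (K) in
/-- The representatives of `w` conjugate the root subgroup of `α_j` into the subgroup generated by
the simple root subgroups. -/
def ConjSimple (hA : IsGeneralizedCartan A) (hS : A.IsSimplyLaced) (w : WeylGroup hA)
    (j : Fin d) : Prop :=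
  ∀ g : KMGroup A K, Represents K hA hS w g → ∀ a : K,
    g * rootElt (RootVector.simple A j) a * g⁻¹ ∈ simpleSubgroup A K

theorem ConjSimple.one (j : Fin d) : ConjSimple K hA hS 1 j := by
  intro g hg a
  obtain ⟨b, hb⟩ := exists_conj_simple_of_mem_torus hg.mem_torus j a
  rw [hb]
  exact rootElt_simple_mem j b

/-- The root `s_i α_j` is `α_j` or `α_i + α_j`. In the latter case its root elements are the
commutators of `x_i(a)` with `x_j(1)`, and conjugation distributes over commutators. -/
theorem ConjSimple.mul_simple {v : WeylGroup hA} {i j : Fin d} (hij : i ≠ j)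
    (hi : ConjSimple K hA hS v i) (hj : ConjSimple K hA hS v j) :
    ConjSimple K hA hS (v * (weylSystem hA).simple i) j := by
  intro g hg a
  have hg' : Represents K hA hS v (g * (weylElt A K i)⁻¹) := by
    have := hg.mul (represents_simple (K := K) hA hS i).inv
    rwa [mul_inv_cancel_right] at this
  have e1 : g * rootElt (RootVector.simple A j) a * g⁻¹ = (g * (weylElt A K i)⁻¹) *
      rootElt ((RootVector.simple A j).refl i) a * (g * (weylElt A K i)⁻¹)⁻¹ := by
    rw [← weylElt_conj_rootElt]; group
  rw [e1]
  rcases hS hij with h | h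
  · rw [refl_simple_of_eq_zero hij h]
    exact hj _ hg' a
  · have h2 := commutator_rootElt_simple hA hS hij h a 1
    rw [mul_one] at h2
    rw [← h2]
    have h3 : ∀ g x y : KMGroup A K, g * ⁅x, y⁆ * g⁻¹ = ⁅g * x * g⁻¹, g * y * g⁻¹⁆ := by
      intro g x y; simp only [commutatorElement_def]; group
    rw [h3, commutatorElement_def]
    exact mul_mem (mul_mem (mul_mem (hi _ hg' a) (hj _ hg' 1)) (inv_mem (hi _ hg' a)))
      (inv_mem (hj _ hg' 1))

theorem ConjSimple.mul_simple_mul_simple {v : WeylGroup hA} {i j : Fin d} (hij : i ≠ j)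
    (h : A i j = -1) (h' : A j i = -1) (hi : ConjSimple K hA hS v i) :
    ConjSimple K hA hS (v * ((weylSystem hA).simple j * (weylSystem hA).simple i)) j := by
  intro g hg a
  have hg' : Represents K hA hS v (g * (weylElt A K j * weylElt A K i)⁻¹) := by
    have := hg.mul ((represents_simple (K := K) hA hS j).mul (represents_simple hA hS i)).inv
    rwa [mul_inv_cancel_right] at this
  have e1 : g * rootElt (RootVector.simple A j) a * g⁻¹ =
      (g * (weylElt A K j * weylElt A K i)⁻¹) *
      rootElt (((RootVector.simple A j).refl i).refl j) a *
      (g * (weylElt A K j * weylElt A K i)⁻¹)⁻¹ := by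
    rw [← weylElt_mul_conj_rootElt]; group
  rw [e1, refl_refl_simple hA hij h h']
  exact hi _ hg' a

/-- The elements of the dihedral group generated by `s` and `t`, if `s` and `t` satisfy a braid
relation of length at most three, together with upper bounds for their lengths. -/
def Alternating {W : Type*} [Monoid W] (s t : W) (u : W) (k : ℕ) : Prop :=
  (u = 1 ∧ k = 0) ∨ (u = s ∧ k = 1) ∨ (u = t ∧ k = 1) ∨ (u = s * t ∧ k = 2) ∨
    (u = t * s ∧ k = 2) ∨ (u = s * t * s ∧ k = 3)

/-- Together with `Alternating.right_mul`, this allows a generator to be moved from the left factor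
of a decomposition into the dihedral factor at the cost of at most one unit of length. -/
theorem Alternating.left_mul {W : Type*} [Monoid W] {s t u : W} {k : ℕ} (hs : s * s = 1)
    (h : Alternating s t u k) :
    ∃ k' ≤ k + 1, Alternating s t (s * u) k' := by
  rcases h with ⟨rfl, rfl⟩ | ⟨rfl, rfl⟩ | ⟨rfl, rfl⟩ | ⟨rfl, rfl⟩ | ⟨rfl, rfl⟩ | ⟨rfl, rfl⟩
  · exact ⟨1, by omega, Or.inr (Or.inl ⟨mul_one _, rfl⟩)⟩
  · exact ⟨0, by omega, Or.inl ⟨hs, rfl⟩⟩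
  · exact ⟨2, by omega, Or.inr (Or.inr (Or.inr (Or.inl ⟨rfl, rfl⟩)))⟩
  · exact ⟨1, by omega, Or.inr (Or.inr (Or.inl ⟨by rw [← mul_assoc, hs, one_mul], rfl⟩))⟩
  · exact ⟨3, by omega, Or.inr (Or.inr (Or.inr (Or.inr (Or.inr ⟨(mul_assoc _ _ _).symm, rfl⟩))))⟩
  · exact ⟨2, by omega, Or.inr (Or.inr (Or.inr (Or.inr (Or.inl
      ⟨by rw [← mul_assoc, ← mul_assoc, hs, one_mul], rfl⟩))))⟩

theorem Alternating.right_mul {W : Type*} [Monoid W] {s t u : W} {k : ℕ}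
    (hs : s * s = 1) (ht : t * t = 1) (hst : s * t = t * s ∨ t * s * t = s * t * s)
    (h : Alternating s t u k) :
    ∃ k' ≤ k + 1, Alternating s t (t * u) k' := by
  rcases h with ⟨rfl, rfl⟩ | ⟨rfl, rfl⟩ | ⟨rfl, rfl⟩ | ⟨rfl, rfl⟩ | ⟨rfl, rfl⟩ | ⟨rfl, rfl⟩
  · exact ⟨1, by omega, Or.inr (Or.inr (Or.inl ⟨mul_one _, rfl⟩))⟩
  · exact ⟨2, by omega, Or.inr (Or.inr (Or.inr (Or.inr (Or.inl ⟨rfl, rfl⟩))))⟩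
  · exact ⟨0, by omega, Or.inl ⟨ht, rfl⟩⟩
  · rcases hst with h | h
    · exact ⟨1, by omega, Or.inr (Or.inl ⟨by rw [h, ← mul_assoc, ht, one_mul], rfl⟩)⟩
    · exact ⟨3, by omega, Or.inr (Or.inr (Or.inr (Or.inr (Or.inr
        ⟨by rw [← mul_assoc, h], rfl⟩))))⟩
  · exact ⟨1, by omega, Or.inr (Or.inl ⟨by rw [← mul_assoc, ht, one_mul], rfl⟩)⟩
  · rcases hst with h | h
    · exact ⟨0, by omega, Or.inl ⟨by rw [h, mul_assoc t s s, hs, mul_one, ht], rfl⟩⟩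
    · exact ⟨2, by omega, Or.inr (Or.inr (Or.inr (Or.inl
        ⟨by rw [← h, ← mul_assoc, ← mul_assoc, ht, one_mul], rfl⟩)))⟩

end KacMoody

namespace KacMoody

variable {d : ℕ} {A : Matrix (Fin d) (Fin d) ℤ} {K : Type*} [Field K]

theorem rootAction_mul_simple (hA : IsGeneralizedCartan A) (hS : A.IsSimplyLaced)
    (w : WeylGroup hA) (i : Fin d) (γ : Fin d → ℤ) :
    rootAction hA hS (w * (weylSystem hA).simple i) γ = rootAction hA hS w (reflection A i γ) := by
  rw [map_mul, rootAction_simple]; rfl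

theorem rootAction_injective (hA : IsGeneralizedCartan A) (hS : A.IsSimplyLaced)
    (w : WeylGroup hA) : Function.Injective (rootAction hA hS w) := by
  intro γ γ' h
  have := congrArg (rootAction hA hS w⁻¹) h
  rw [← Module.End.mul_apply, ← Module.End.mul_apply, ← map_mul, inv_mul_cancel, map_one] at this
  exact this

/-- An element of the Weyl group can be written as the product of an element of smaller length,
without right descents in `{i, j}`, and an element of the dihedral group generated by the `i`-th and
the `j`-th simple reflections. -/
theorem exists_parabolic_decomposition (hA : IsGeneralizedCartan A) {w : WeylGroup hA}
    {i j : Fin d} (hij : i ≠ j)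
    (hi : (weylSystem hA).length (w * (weylSystem hA).simple i) < (weylSystem hA).length w) :
    ∃ (v u : WeylGroup hA) (k : ℕ),
      Alternating ((weylSystem hA).simple i) ((weylSystem hA).simple j) u k ∧ w = v * u ∧
      (weylSystem hA).length v + k ≤ (weylSystem hA).length w ∧
      (weylSystem hA).length v < (weylSystem hA).length w ∧
      (weylSystem hA).length v < (weylSystem hA).length (v * (weylSystem hA).simple i) ∧
      (weylSystem hA).length v < (weylSystem hA).length (v * (weylSystem hA).simple j) := by
  classical
  set cs := weylSystem hA
  have hss : cs.simple i * cs.simple j = cs.simple j * cs.simple i ∨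
      cs.simple j * cs.simple i * cs.simple j = cs.simple i * cs.simple j * cs.simple i := by
    by_cases h : A i j = 0
    · exact Or.inl (simple_commute hA hij h)
    · exact Or.inr (simple_braid hA hij h)
  have hex : ∃ n, ∃ (v u : WeylGroup hA) (k : ℕ), cs.length v = n ∧
      Alternating (cs.simple i) (cs.simple j) u k ∧ w = v * u ∧ cs.length v + k ≤ cs.length w :=
    ⟨_, w * cs.simple i, cs.simple i, 1, rfl, Or.inr (Or.inl ⟨rfl, rfl⟩),
      (cs.simple_mul_simple_cancel_right i).symm, hi⟩
  -- Take `v` of minimal length. A right descent of `v` in `{i, j}` could be moved into `u`, giving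
  -- a shorter `v`.
  obtain ⟨v, u, k, hv, hu, hw, hk⟩ := Nat.find_spec hex
  have hmin : ∀ (v' u' : WeylGroup hA) (k' : ℕ), Alternating (cs.simple i) (cs.simple j) u' k' →
      w = v' * u' → cs.length v' + k' ≤ cs.length w → cs.length v ≤ cs.length v' := by
    intro v' u' k' h1 h2 h3
    rw [hv]
    exact Nat.find_min' hex ⟨v', u', k', rfl, h1, h2, h3⟩
  refine ⟨v, u, k, hu, hw, hk, ?_, ?_, ?_⟩
  · exact (hmin _ _ 1 (Or.inr (Or.inl ⟨rfl, rfl⟩))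
      (cs.simple_mul_simple_cancel_right i).symm hi).trans_lt hi
  · by_contra hlt
    have h1 : cs.length (v * cs.simple i) + 1 = cs.length v :=
      (cs.length_mul_simple v i).resolve_left (by omega)
    obtain ⟨k', hk', hu'⟩ := hu.left_mul (cs.simple_mul_simple_self i)
    have := hmin _ _ k' hu' (by
      rw [← mul_assoc, cs.simple_mul_simple_cancel_right, hw]) (by omega)
    omega
  · by_contra hlt
    have h1 : cs.length (v * cs.simple j) + 1 = cs.length v :=
      (cs.length_mul_simple v j).resolve_left (by omega)
    obtain ⟨k', hk', hu'⟩ := hu.right_mul (cs.simple_mul_simple_self i)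
      (cs.simple_mul_simple_self j) hss
    have := hmin _ _ k' hu' (by
      rw [← mul_assoc, cs.simple_mul_simple_cancel_right, hw]) (by omega)
    omega

/-- If `w s_j` is longer than `w`, then `w α_j` is positive, and its root subgroup is contained in
the subgroup generated by the simple root subgroups. -/
theorem nonneg_and_conjSimple_of_length_lt (hA : IsGeneralizedCartan A) (hS : A.IsSimplyLaced)
    (w : WeylGroup hA) (j : Fin d)
    (hw : (weylSystem hA).length w < (weylSystem hA).length (w * (weylSystem hA).simple j)) :
    0 ≤ rootAction hA hS w (simpleRoot j) ∧ ConjSimple K hA hS w j := by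
  induction hn : (weylSystem hA).length w using Nat.strong_induction_on generalizing w j with
  | _ n ih =>
  subst hn
  by_cases hw1 : w = 1
  · subst hw1
    rw [map_one]
    exact ⟨simpleRoot_nonneg j, ConjSimple.one j⟩
  obtain ⟨i, hi⟩ := (weylSystem hA).exists_rightDescent_of_ne_one hw1
  have hij : i ≠ j := by
    rintro rfl
    exact absurd hi (not_lt.2 hw.le)
  obtain ⟨v, u, k, hu, hwv, hk, hvw, hvi, hvj⟩ := exists_parabolic_decomposition hA hij hi
  obtain ⟨hposi, hconji⟩ := ih _ hvw v i hvi rfl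
  obtain ⟨hposj, hconjj⟩ := ih _ hvw v j hvj rfl
  -- As `w s_j` is longer than `w`, multiplying `u` by `s_j` must lengthen it. This leaves only `u =
  -- s_i`, and `u = s_j s_i` in the non-commuting case, where `u α_j = α_i`.
  have hshort : ∀ (u' : WeylGroup hA) (l : ℕ), u * (weylSystem hA).simple j = u' →
      (weylSystem hA).length u' ≤ l → k < l := by
    intro u' l h1 h2
    have h3 : w * (weylSystem hA).simple j = v * u' := by rw [hwv, mul_assoc, h1]
    have h4 := (weylSystem hA).length_mul_le v u'
    rw [← h3] at h4
    omega
  have hl2 : ∀ a b,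
      (weylSystem hA).length ((weylSystem hA).simple a * (weylSystem hA).simple b) ≤ 2 := fun a b => by
    have := (weylSystem hA).length_mul_le ((weylSystem hA).simple a) ((weylSystem hA).simple b)
    rwa [(weylSystem hA).length_simple, (weylSystem hA).length_simple] at this
  have hcancel := (weylSystem hA).simple_mul_simple_cancel_right (w := (weylSystem hA).simple i) j
  rcases hu with ⟨rfl, rfl⟩ | ⟨rfl, rfl⟩ | ⟨rfl, rfl⟩ | ⟨rfl, rfl⟩ | ⟨rfl, rfl⟩ | ⟨rfl, rfl⟩
  · rw [mul_one] at hwv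
    rw [hwv] at hvw
    exact absurd hvw (lt_irrefl _)
  · subst hwv
    refine ⟨?_, ConjSimple.mul_simple hij hconji hconjj⟩
    rw [rootAction_mul_simple]
    rcases hS hij with h | h
    · rw [reflection_simpleRoot_of_eq_zero h]; exact hposj
    · rw [reflection_simpleRoot_of_eq_neg_one h, map_add]; exact add_nonneg hposi hposj
  · exact absurd (hshort 1 0 ((weylSystem hA).simple_mul_simple_self j)
      (by rw [(weylSystem hA).length_one])) (by omega)
  · exact absurd (hshort _ 1 hcancel (by rw [(weylSystem hA).length_simple])) (by omega)
  · rcases hS hij with h | h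
    · refine absurd (hshort ((weylSystem hA).simple i) 1 ?_
        (by rw [(weylSystem hA).length_simple])) (by omega)
      rw [← simple_commute hA hij h, hcancel]
    · have h' : A j i = -1 := by rw [← cartan_symm hA hS, h]
      subst hwv
      refine ⟨?_, ConjSimple.mul_simple_mul_simple hij h h' hconji⟩
      rw [← mul_assoc, rootAction_mul_simple, rootAction_mul_simple,
        reflection_reflection_simpleRoot hA h h']
      exact hposi
  · rcases hS hij with h | h
    · refine absurd (hshort 1 0 ?_ (by rw [(weylSystem hA).length_one])) (by omega)
      rw [simple_commute hA hij h, (weylSystem hA).simple_mul_simple_cancel_right,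
        (weylSystem hA).simple_mul_simple_self]
    · refine absurd (hshort ((weylSystem hA).simple j * (weylSystem hA).simple i) 2 ?_ (hl2 j i))
        (by omega)
      rw [← simple_braid hA hij (by rw [h]; norm_num),
        (weylSystem hA).simple_mul_simple_cancel_right]

/-- Every real root subgroup is conjugate to a simple one. -/
theorem exists_represents_of_isRealRootVector (hA : IsGeneralizedCartan A)
    (hS : A.IsSimplyLaced) {γ : Fin d → ℤ} {x : Alg A} (hx : IsRealRootVector A γ x) :
    ∃ (w : WeylGroup hA) (j : Fin d) (g : KMGroup A K) (s : K), Represents K hA hS w g ∧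
      γ = rootAction hA hS w (simpleRoot j) ∧
      ∀ a, rootElt ⟨γ, x, hx⟩ a = g * rootElt (RootVector.simple A j) (s * a) * g⁻¹ := by
  induction hx with
  | pos i =>
    refine ⟨1, i, 1, 1, represents_one hA hS, by rw [map_one]; rfl, fun a => ?_⟩
    rw [one_mul, one_mul, inv_one, mul_one]; rfl
  | neg i =>
    refine ⟨(weylSystem hA).simple i, i, weylElt A K i, -1, represents_simple hA hS i, ?_,
      fun a => ?_⟩
    · rw [rootAction_simple, reflection_simpleRoot_self hA]
    · rw [weylElt_conj_rootElt, refl_simple_self hA, rootElt_opp, neg_one_mul, neg_neg]; rfl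
  | opp h ih =>
    obtain ⟨w, j, g, s, hg, hγ, he⟩ := ih
    refine ⟨w, j, g, -s, hg, hγ, fun a => ?_⟩
    have h1 := rootElt_opp ⟨_, _, h⟩ a
    rw [he] at h1
    rw [neg_mul, ← mul_neg]
    exact h1
  | refl i h ih =>
    obtain ⟨w, j, g, s, hg, hγ, he⟩ := ih
    refine ⟨(weylSystem hA).simple i * w, j, weylElt A K i * g, s,
      (represents_simple hA hS i).mul hg, ?_, fun a => ?_⟩
    · rw [map_mul, rootAction_simple, hγ]; rfl
    · have h1 := weylElt_conj_rootElt i ⟨_, _, h⟩ a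
      rw [he] at h1
      refine h1.symm.trans ?_
      group

theorem rootElt_mem_simpleSubgroup (hA : IsGeneralizedCartan A) (hS : A.IsSimplyLaced)
    (e : RootVector A) (he : 0 ≤ e.root) (a : K) : rootElt e a ∈ simpleSubgroup A K := by
  obtain ⟨w, j, g, s, hg, hγ, hx⟩ := exists_represents_of_isRealRootVector (K := K) hA hS e.isReal
  have h1 : rootElt e a = g * rootElt (RootVector.simple A j) (s * a) * g⁻¹ := hx a
  rw [h1]
  rcases (weylSystem hA).length_mul_simple w j with h | h
  · exact (nonneg_and_conjSimple_of_length_lt hA hS w j (by omega)).2 g hg (s * a)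
  -- If `w s_j` is shorter than `w`, then `w α_j` is also nonpositive, hence zero, although `w` acts
  -- injectively.
  · exfalso
    have h2 := (nonneg_and_conjSimple_of_length_lt (K := K) hA hS
        (w * (weylSystem hA).simple j) j (by
      rw [(weylSystem hA).simple_mul_simple_cancel_right]; omega)).1
    rw [rootAction_mul_simple, reflection_simpleRoot_self hA, map_neg, ← hγ] at h2
    have h3 : e.root = 0 := le_antisymm (neg_nonneg.1 h2) he
    rw [h3, ← map_zero (rootAction hA hS w)] at hγ
    have h4 := congrFun (rootAction_injective hA hS w hγ) j
    simp [simpleRoot] at h4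

theorem positiveUnipotent_eq_simpleSubgroup (hA : IsGeneralizedCartan A) (hS : A.IsSimplyLaced) :
    positiveUnipotent A K = simpleSubgroup A K := by
  apply le_antisymm
  · rw [positiveUnipotent, Subgroup.closure_le]
    rintro _ ⟨e, a, he, rfl⟩
    exact rootElt_mem_simpleSubgroup hA hS e he a
  · rw [simpleSubgroup, Subgroup.closure_le]
    rintro _ ⟨i, a, rfl⟩
    exact Subgroup.subset_closure ⟨_, a, simpleRoot_nonneg i, rfl⟩

/-! ### Simple root subgroups as pairs with central commutators. -/

variable (A K) in
/-- The simple root subgroups as families of elements of the positive unipotent subgroup. -/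
noncomputable def simpleElt (i : Fin d) (a : K) : positiveUnipotent A K :=
  ⟨rootElt (RootVector.simple A i) a,
    Subgroup.subset_closure ⟨_, a, simpleRoot_nonneg i, rfl⟩⟩

theorem simpleElt_add (i : Fin d) (a b : K) :
    simpleElt A K i (a + b) = simpleElt A K i a * simpleElt A K i b :=
  Subtype.ext (rootElt_add _ a b)

theorem simpleRootUnion_eq : simpleRootUnion A K = {g | ∃ i a, g = simpleElt A K i a} := by
  ext g
  exact exists_congr fun i => exists_congr fun a =>
    (Subtype.ext_iff (a2 := simpleElt A K i a)).symm

theorem closure_simpleElt (hA : IsGeneralizedCartan A) (hS : A.IsSimplyLaced) :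
    Subgroup.closure {g | ∃ i a, g = simpleElt A K i a} = ⊤ := by
  rw [eq_top_iff]
  rintro ⟨g, hg⟩ -
  have h1 : simpleSubgroup A K ≤ (Subgroup.closure {g | ∃ i a, g = simpleElt A K i a}).map
      (positiveUnipotent A K).subtype := by
    rw [simpleSubgroup, Subgroup.closure_le]
    rintro _ ⟨i, a, rfl⟩
    exact ⟨simpleElt A K i a, Subgroup.subset_closure ⟨i, a, rfl⟩, rfl⟩
  obtain ⟨x, hx, hxg⟩ := h1 (positiveUnipotent_eq_simpleSubgroup (K := K) hA hS ▸ hg)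
  have : x = ⟨g, hg⟩ := Subtype.ext hxg
  exact this ▸ hx

theorem centralPair_simpleElt (hA : IsGeneralizedCartan A) (hS : A.IsSimplyLaced) {i j : Fin d}
    (hij : i ≠ j) : CentralPair (simpleElt A K i) (simpleElt A K j) ∧
      ∀ N : ℕ, (N : ℕ∞) ≤ Nat.card K →
        CentralPair.IndexBound (simpleElt A K i) (simpleElt A K j) N := by
  rcases hS hij with h | h
  · obtain ⟨h1, h2⟩ := CentralPair.of_commute (simpleElt_add (A := A) (K := K) i)
      (simpleElt_add (A := A) (K := K) j) fun a b => Subtype.ext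
        (commute_rootElt _ _ a b (isPrenilpotent_of_eq_zero hA h)
          (not_isRealRoot_add_of_eq_zero hA hS h)).eq
    exact ⟨h1, fun N _ => h2 N⟩
  · have hcomm : ∀ a b : K, ((⁅simpleElt A K i a, simpleElt A K j b⁆ : positiveUnipotent A K) :
        KMGroup A K) = rootElt ((RootVector.simple A j).refl i) (a * b) :=
      commutator_rootElt_simple hA hS hij h
    refine ⟨⟨simpleElt_add i, simpleElt_add j, fun a b c => Subtype.ext ?_,
      fun a b c => Subtype.ext ?_⟩, ?_⟩
    · rw [Subgroup.coe_mul, Subgroup.coe_mul, hcomm, refl_simple_of_eq_neg_one hij h]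
      refine (commute_rootElt _ _ _ _ ?_ (not_isRealRoot_add_add hA hS h (Or.inl rfl))).eq
      simpa [RootVector.simple] using
        isPrenilpotent_of_mem_span hA hS h (p := 1) (q := 1) (r := 1) (s := 0)
    · rw [Subgroup.coe_mul, Subgroup.coe_mul, hcomm, refl_simple_of_eq_neg_one hij h]
      refine (commute_rootElt _ _ _ _ ?_ (not_isRealRoot_add_add hA hS h (Or.inr rfl))).eq
      simpa [RootVector.simple] using
        isPrenilpotent_of_mem_span hA hS h (p := 1) (q := 1) (r := 0) (s := 1)
    · intro N hN L hL htop
      -- The commutator depends only on the product `a * b`, so a scalar passes from one argument to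
      -- the other. Thus `L` is a subspace of the line `K`; being proper it is zero, of index
      -- `Nat.card K`.
      have hmul : ∀ x ∈ L, ∀ r : K, r * x ∈ L := fun x hx r => by
        refine hL x hx _ fun y => ⟨r * y, Subtype.ext ?_⟩
        rw [hcomm, hcomm]
        congr 1
        ring
      have hbot : L = ⊥ := by
        rw [AddSubgroup.eq_bot_iff_forall]
        intro x hx
        by_contra hx0
        refine htop ((AddSubgroup.eq_top_iff' L).2 fun y => ?_)
        have := hmul x hx (y * x⁻¹)
        rwa [mul_assoc, inv_mul_cancel₀ hx0, mul_one] at this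
      left
      rw [hbot, AddSubgroup.index_bot]
      exact_mod_cast hN

end KacMoody

/-! ### The two parts of the theorem. -/

theorem mainTheorem11 :
    (∀ (d : ℕ) (_ : 0 < d) (X : SimpleGraph (Fin d)) (M : Fin d → Type u)
        [∀ i, AddCommGroup (M i)] [∀ i, AddGroup.FG (M i)]
        (R : KMSEdge X → Type w) [∀ e, Ring (R e)]
        [∀ e : KMSEdge X, Module (R e)ᵐᵒᵖ (M e.1.1)] [∀ e : KMSEdge X, Module (R e) (M e.1.2)]
        (m : ℕ∞) (_ : m = ⨅ e : KMSEdge X, minRightIdealIndex (R e))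
        (_ : (((d - 1) ^ 2 : ℕ) : ℕ∞) < m),
        ENNReal.ofReal (Real.sqrt (2 / (d : ℝ) * (1 - ((d : ℝ) - 1) * m.invSqrt))) ≤
            kazhdanConst.{v} (KMSGroup X M R) (KMSGroup.vertexUnion X M R) ∧
          ((∀ i, Finite (M i)) → HasPropertyT.{v} (KMSGroup X M R))) ∧
    (∀ (d : ℕ) (_ : 0 < d) (A : Matrix (Fin d) (Fin d) ℤ) (_ : IsGeneralizedCartan A)
        (_ : A.IsSimplyLaced) (F : Type u) [Field F] [Finite F]
        (_ : (d - 1) ^ 2 < Nat.card F),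
        HasPropertyT.{v} (KacMoody.positiveUnipotent A F) ∧
          ENNReal.ofReal
              (Real.sqrt (2 / (d : ℝ) * (1 - ((d : ℝ) - 1) / Real.sqrt (Nat.card F)))) ≤
            kazhdanConst.{v} (KacMoody.positiveUnipotent A F)
              (KacMoody.simpleRootUnion A F)) := by
  refine ⟨?_, ?_⟩
  · intro d hd X M _ _ R _ _ _ m hm hlt
    have hpair : ∀ i j, i < j → _ := fun i j hij => KMSGroup.centralPair_gen X M R hij hm
    exact ⟨ofReal_sqrt_le_kazhdanConst.{v} hd (KMSGroup.gen X M R) (KMSGroup.gen_add X M R)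
        (KMSGroup.closure_gen X M R) (Order.one_le_iff_pos.2 (bot_le.trans_lt hlt)) hpair,
      hasPropertyT_of_finite.{v} hd (KMSGroup.gen X M R) (KMSGroup.gen_add X M R)
        (KMSGroup.closure_gen X M R) hlt hpair⟩
  · intro d hd A hA hS F _ _ hlt
    have hlt' : (((d - 1) ^ 2 : ℕ) : ℕ∞) < (Nat.card F : ℕ∞) := by exact_mod_cast hlt
    have hpair : ∀ i j : Fin d, i < j → _ := fun i j hij =>
      KacMoody.centralPair_simpleElt (K := F) hA hS hij.ne
    refine ⟨hasPropertyT_of_finite.{v} hd (KacMoody.simpleElt A F) KacMoody.simpleElt_add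
      (KacMoody.closure_simpleElt hA hS) hlt' hpair fun _ => inferInstance, ?_⟩
    have h := ofReal_sqrt_le_kazhdanConst.{v} hd (KacMoody.simpleElt A F) KacMoody.simpleElt_add
      (KacMoody.closure_simpleElt hA hS) (Order.one_le_iff_pos.2 (bot_le.trans_lt hlt')) hpair
    rwa [ENat.invSqrt_coe, mul_one_div, ← KacMoody.simpleRootUnion_eq] at h
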